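/- Let $n$ be a nonnegative integer. Let $X,Z$ be the Pauli matrices ($Xv_l=v_{l+1}$, $Zv_l=(-1)^lv_l$, $l\in\mathbb Z_2$), let $\mathcal P_n\subset U(2^n)$ be the $n$-qubit Pauli group of all $n$-fold tensor products of elements of $\langle X,Z,iI_2\rangle$, and let $\mathcal C_n=\mathrm{Cliff}(n)/U(1)$ be the projective Clifford group, where $\mathrm{Cliff}(n)$ is the normalizer of $\mathcal P_n$ in $U(2^n)$ and $U(1)$ is its subgroup of scalar matrices. For $x=(p,q)\in\mathbb Z_2^{2n}$, with coordinates represented by $0,1$, let $W_x=i^{-p\cdot q}(Z^{p_1}X^{q_1})\otimes\cdots\otimes(Z^{p_n}X^{q_n})$. Let $Sp(2n,2)\ltimes\mathbb Z_2^{2n}$ be the affine symplectic group, with $Sp(2n,2)$ acting on $\mathbb Z_2^{2n}$ in the natural way. Call $t:Sp(2n,2)\to\mathcal C_n$ an adapted section if $t(1)=1$ and, for every $\Gamma\in Sp(2n,2)$ and every $U\in\mathrm{Cliff}(n)$ representing $t(\Gamma)$: (a) $UW_xU^\dagger=\pm W_{\Gamma x}$ for all $x\in\mathbb Z_2^{2n}$,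 and (b) $UW_vU^\dagger=W_v$ (with no sign) for every $v\in\mathbb Z_2^{2n}$ with $\Gamma v=v$. Then: 1. The groups $Sp(2n,2)\ltimes\mathbb Z_2^{2n}$ and $\mathcal C_n$ have identical character tables: there are a bijection between their conjugacy classes and a bijection between their complex irreducible characters under which all values of the irreducible characters agree. 2. Adapted sections exist. 3. For every adapted section $t$, the map $\phi:Sp(2n,2)\ltimes\mathbb Z_2^{2n}\to\mathcal C_n$, $\phi(x,\Gamma)=[W_x]\,t(\Gamma)$, is a bijection; $r,s$ are conjugate in $Sp(2n,2)\ltimes\mathbb Z_2^{2n}$ if and only if $\phi(r),\phi(s)$ are conjugate in $\mathcal C_n$; and a function $\chi:\mathcal C_n\to\mathbb C$ is an irreducible character of $\mathcal C_n$ if and only if $\chi\circ\phi$ is an irreducible character of $Sp(2n,2)\ltimes\mathbb Z_2^{2n}$. -/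

import Mathlib

open Matrix

noncomputable section

namespace CliffordTables

/-! ### Qubits, Pauli group, Clifford group -/

/-- The group of `2 × 2` unitary matrices; the basis vectors `v_0, v_1` are indexed by `ZMod 2`. -/
abbrev U2 : Type := Matrix.unitaryGroup (ZMod 2) ℂ

/-- The group `U(2 ^ n)`; the standard basis `v_{r_1} ⊗ ⋯ ⊗ v_{r_n}` of `(ℂ²)^{⊗ n}` is indexed by
the functions `r : Fin n → ZMod 2`. -/
abbrev UN (n : ℕ) : Type := Matrix.unitaryGroup (Fin n → ZMod 2) ℂ

/-- The Kronecker product `A_1 ⊗ ⋯ ⊗ A_n` of `n` matrices of size `2 × 2`. -/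
def kron {n : ℕ} (A : Fin n → Matrix (ZMod 2) (ZMod 2) ℂ) :
    Matrix (Fin n → ZMod 2) (Fin n → ZMod 2) ℂ :=
  Matrix.of fun r s => ∏ k, A k (r k) (s k)

theorem kron_mul {n : ℕ} (A B : Fin n → Matrix (ZMod 2) (ZMod 2) ℂ) :
    kron (fun k => A k * B k) = kron A * kron B := by
  ext r s
  simp only [kron, Matrix.of_apply, Matrix.mul_apply]
  rw [Finset.prod_univ_sum, Fintype.piFinset_univ]
  exact Finset.sum_congr rfl fun x _ => Finset.prod_mul_distrib

theorem kron_one {n : ℕ} : kron (fun _ : Fin n => (1 : Matrix (ZMod 2) (ZMod 2) ℂ)) = 1 := by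
  ext r s
  simp only [kron, Matrix.of_apply, Matrix.one_apply]
  by_cases h : r = s
  · subst h
    simp
  · obtain ⟨k, hk⟩ := Function.ne_iff.mp h
    rw [if_neg h]
    exact Finset.prod_eq_zero (Finset.mem_univ k) (if_neg hk)

theorem kron_star {n : ℕ} (A : Fin n → Matrix (ZMod 2) (ZMod 2) ℂ) :
    star (kron A) = kron (fun k => star (A k)) := by
  ext r s
  simp [kron, Matrix.star_apply]

/-- The tensor product of `n` one-qubit unitaries, as a group homomorphism
`U(2) × ⋯ × U(2) → U(2 ^ n)`. -/
def tensor (n : ℕ) : (Fin n → U2) →* UN n where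
  toFun A := ⟨kron fun k => (A k : Matrix (ZMod 2) (ZMod 2) ℂ), by
    rw [Matrix.mem_unitaryGroup_iff, kron_star, ← kron_mul, ← kron_one]
    congr 1
    funext k
    exact Matrix.mem_unitaryGroup_iff.mp (A k).2⟩
  map_one' := Subtype.ext kron_one
  map_mul' A B := Subtype.ext (kron_mul _ _)

/-- The operator `X v_l = v_{l+1}`. -/
def X : U2 := ⟨Matrix.of fun r s => if r = s + 1 then 1 else 0, by
  rw [Matrix.mem_unitaryGroup_iff]
  have h : ∀ r x : ZMod 2, r = x + 1 ↔ x = r + 1 := by decide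
  ext r s
  simp [Matrix.mul_apply, Matrix.star_apply, Matrix.one_apply, h, eq_comm]⟩

/-- The operator `Z v_l = (-1)^l v_l`. -/
def Z : U2 := ⟨Matrix.diagonal fun l : ZMod 2 => (-1 : ℂ) ^ l.val, by
  rw [Matrix.mem_unitaryGroup_iff, Matrix.star_eq_conjTranspose, Matrix.diagonal_conjTranspose,
    Matrix.diagonal_mul_diagonal, ← Matrix.diagonal_one]
  congr 1
  funext l
  simp [← mul_pow]⟩

/-- The scalar operator `i I_2`. -/
def iI : U2 := ⟨Complex.I • 1, by
  rw [Matrix.mem_unitaryGroup_iff]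
  simp [smul_smul]⟩

/-- The one-qubit Pauli group `P_1 = ⟨X, Z, i I_2⟩`. -/
def pauliOne : Subgroup U2 := Subgroup.closure {X, Z, iI}

/-- The `n`-qubit Pauli group: all `n`-fold tensor products of elements of `P_1`. -/
def pauli (n : ℕ) : Subgroup (UN n) :=
  (Subgroup.pi Set.univ fun _ : Fin n => pauliOne).map (tensor n)

/-- The Clifford group `Cliff(n)`: the normalizer of the Pauli group in `U(2 ^ n)`. -/
def cliff (n : ℕ) : Subgroup (UN n) := Subgroup.normalizer (pauli n : Set (UN n))

/-- The subgroup `U(1)` of global phases in `Cliff(n)`. -/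
def phases (n : ℕ) : Subgroup (cliff n) where
  carrier := {U | ∃ c : ℂ,
    ((U : UN n) : Matrix (Fin n → ZMod 2) (Fin n → ZMod 2) ℂ) = c • 1}
  one_mem' := ⟨1, by simp⟩
  mul_mem' := by
    rintro U V ⟨c, hc⟩ ⟨d, hd⟩
    exact ⟨c * d, by simp [hc, hd, smul_smul, mul_comm]⟩
  inv_mem' := by
    rintro U ⟨c, hc⟩
    exact ⟨star c, by simp [hc]⟩

instance phases_normal (n : ℕ) : (phases n).Normal where
  conj_mem := by
    rintro U ⟨c, hc⟩ V
    refine ⟨c, ?_⟩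
    have hV := Matrix.mem_unitaryGroup_iff.mp (V : UN n).2
    simp [hc, hV]

/-- The projective Clifford group `C_n = Cliff(n) / U(1)`. -/
abbrev ProjClifford (n : ℕ) : Type := cliff n ⧸ phases n

/-! ### Phase space and Weyl operators -/

/-- The space `Z_2^{2n}`: a vector `x = (p, q)` has `p k = x (Sum.inl k)`, `q k = x (Sum.inr k)`. -/
abbrev Vec (n : ℕ) : Type := Fin n ⊕ Fin n → ZMod 2

/-- The Weyl operator `W_x = i^{-p·q} (Z^{p_1} X^{q_1}) ⊗ ⋯ ⊗ (Z^{p_n} X^{q_n})` of `x = (p, q)`,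
where `p_k, q_k ∈ {0, 1}`; the phase `i^{-p·q}` is distributed over the tensor factors. -/
def weyl {n : ℕ} (x : Vec n) : UN n :=
  tensor n fun k =>
    iI⁻¹ ^ ((x (Sum.inl k)).val * (x (Sum.inr k)).val) *
      (Z ^ (x (Sum.inl k)).val * X ^ (x (Sum.inr k)).val)

theorem weyl_mem_pauli {n : ℕ} (x : Vec n) : weyl x ∈ pauli n := by
  refine Subgroup.mem_map_of_mem _ ?_
  intro k _
  have hX : X ∈ pauliOne := Subgroup.subset_closure (by simp)
  have hZ : Z ∈ pauliOne := Subgroup.subset_closure (by simp)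
  have hI : iI ∈ pauliOne := Subgroup.subset_closure (by simp)
  exact mul_mem (pow_mem (inv_mem hI) _) (mul_mem (pow_mem hZ _) (pow_mem hX _))

/-- The class of the Weyl operator `W_x` in the projective Clifford group. -/
def weylClass {n : ℕ} (x : Vec n) : ProjClifford n :=
  QuotientGroup.mk ⟨weyl x, Subgroup.le_normalizer (weyl_mem_pauli x)⟩

/-! ### Symplectic and affine symplectic groups -/

/-- The symplectic group `Sp(2n, 2)`. -/
abbrev Sp (n : ℕ) : Type := Matrix.symplecticGroup (Fin n) (ZMod 2)

/-- The natural linear action `x ↦ Γ x` of a symplectic matrix on `Z_2^{2n}`. -/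
def act {n : ℕ} (Γ : Sp n) (x : Vec n) : Vec n :=
  (Γ : Matrix (Fin n ⊕ Fin n) (Fin n ⊕ Fin n) (ZMod 2)) *ᵥ x

theorem act_one {n : ℕ} (x : Vec n) : act 1 x = x := by
  simp [act]

theorem act_mul {n : ℕ} (Γ Δ : Sp n) (x : Vec n) : act (Γ * Δ) x = act Γ (act Δ x) := by
  simp [act, Matrix.mulVec_mulVec]

/-- The action of `Sp(2n, 2)` by automorphisms of the group `Z_2^{2n}`, written
multiplicatively. -/
def actHom (n : ℕ) : Sp n →* MulAut (Multiplicative (Vec n)) where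
  toFun Γ :=
    { toFun := fun v => Multiplicative.ofAdd (act Γ v.toAdd)
      invFun := fun v => Multiplicative.ofAdd (act Γ⁻¹ v.toAdd)
      left_inv := fun v => by simp [← act_mul, act_one]
      right_inv := fun v => by simp [← act_mul, act_one]
      map_mul' := fun v w => by simp [act, Matrix.mulVec_add] }
  map_one' := by
    ext v : 1
    simp [act_one]
  map_mul' Γ Δ := by
    ext v : 1
    exact congrArg Multiplicative.ofAdd (act_mul Γ Δ v.toAdd)

/-- The affine symplectic group `Sp(2n, 2) ⋉ Z_2^{2n}`. -/
abbrev AffineSp (n : ℕ) : Type := Multiplicative (Vec n) ⋊[actHom n] Sp n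

/-! ### Sections of the Clifford extension -/

/-- `c ∈ C_n` lies over `Γ ∈ Sp(2n, 2)` in the extension `Z_2^{2n} → C_n → Sp(2n, 2)`:
one has `U W_x U† = ± W_{Γ x}` for all `x`, where `U` is any representative of `c`. -/
def LiesOver {n : ℕ} (c : ProjClifford n) (Γ : Sp n) : Prop :=
  ∀ U : cliff n, (QuotientGroup.mk U : ProjClifford n) = c → ∀ x : Vec n,
    ((U : UN n) * weyl x * (U : UN n)⁻¹ : UN n) = weyl (act Γ x) ∨
    ((U : UN n) * weyl x * (U : UN n)⁻¹ : UN n) = -weyl (act Γ x)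

/-- A normalized section `t` of the extension `Z_2^{2n} → C_n → Sp(2n, 2)` for which conjugation by
`t Γ` fixes, without a sign, every Weyl operator `W_v` with `Γ v = v`. -/
structure IsAdaptedSection {n : ℕ} (t : Sp n → ProjClifford n) : Prop where
  liesOver : ∀ Γ : Sp n, LiesOver (t Γ) Γ
  normalized : t 1 = 1
  fixes : ∀ (Γ : Sp n) (v : Vec n), act Γ v = v →
    ∀ U : cliff n, (QuotientGroup.mk U : ProjClifford n) = t Γ →
      ((U : UN n) * weyl v * (U : UN n)⁻¹ : UN n) = weyl v

/-- The map `φ(x, Γ) = W_x t(Γ)` from the affine symplectic group to `C_n`. -/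
def phi {n : ℕ} (t : Sp n → ProjClifford n) (s : AffineSp n) : ProjClifford n :=
  weylClass s.left.toAdd * t s.right

/-! ### Character tables -/

/-- `χ` is the character of an irreducible finite-dimensional complex representation of `G`. -/
def IsIrreducibleCharacter {G : Type} [Group G] (χ : G → ℂ) : Prop :=
  ∃ (V : Type) (_ : AddCommGroup V) (_ : Module ℂ V) (_ : FiniteDimensional ℂ V)
    (ρ : Representation ℂ G V), ρ.IsIrreducible ∧ ρ.character = χ

/-- `G` and `H` have identical character tables: some bijection `e` of the columns (conjugacy
classes) and some bijection `E` of the rows (irreducible characters) identify all the entries. -/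
def HaveIdenticalCharacterTables (G H : Type) [Group G] [Group H] : Prop :=
  ∃ (e : ConjClasses G ≃ ConjClasses H)
    (E : {χ : G → ℂ // IsIrreducibleCharacter χ} ≃ {χ : H → ℂ // IsIrreducibleCharacter χ}),
    ∀ (χ : {χ : G → ℂ // IsIrreducibleCharacter χ}) (g : G) (h : H),
      e (ConjClasses.mk g) = ConjClasses.mk h → (E χ).1 h = χ.1 g

end CliffordTables

end

noncomputable section

namespace CliffordTables

/-! ### Signs and the symplectic form -/

/-! The extension `Z_2^{2n} → C_n → Sp(2n, 2)` is split inside the group algebra `ℂ[C_n]`, by an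
argument that needs no splitting in `C_n` itself.

The Weyl classes span a commutative subalgebra with orthogonal idempotents `e_a`, one for each
character `[·, a]`, and an element `c` over `Γ` satisfies `c e_a = e_{Γa} c`. Write `c W_a c⁻¹ =
(-1)^{sgn c a} W_{Γa}`. The element `signed c = ∑ (-1)^{sgn c a} c e_a` is multiplicative in `c`,
because `sgn` obeys a cocycle rule (`signed_mul`), and it is `1` on Weyl classes, because `W_x e_a =
(-1)^{[x,a]} e_a` carries the same sign as `W_x W_a W_x⁻¹` (`signed_weylClass`). So it depends only
on `Γ`, and `(x, Γ) ↦ W_x · signed (t Γ)` is a homomorphism `psi` that extends to an isomorphism of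
group algebras (`lift_psi_bijective`).

Under a trace, `c e_a` contributes only if `Γa = a`, and there an adapted section has sign `+`.
Hence every trace agrees on `psi s` and `phi t s` (`trace_psi`). Applied to class indicators and to
irreducible characters, this gives the statements on conjugacy and on characters.

Adapted sections exist for two reasons. Every `Γ` lifts to `C_n`, since transvections generate
`Sp(2n, 2)` and are implemented by `(1 + i W_v)/√2`. Moreover, `sgn c` is linear on the fixed space
of `Γ`, so multiplying by a Weyl class cancels it there. -/

theorem forall_zmod_two {P : ZMod 2 → Prop} : (∀ x, P x) ↔ P 0 ∧ P 1 :=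
  Fin.forall_fin_two

theorem sum_zmod_two {M : Type*} [AddCommMonoid M] (f : ZMod 2 → M) : ∑ x, f x = f 0 + f 1 :=
  Fin.sum_univ_two f

/-- The sign `(-1) ^ z` of `z ∈ ℤ / 2`. -/
def sg (z : ZMod 2) : ℂ := (-1) ^ z.val

@[simp] theorem sg_zero : sg 0 = 1 := by simp [sg]

@[simp] theorem sg_one : sg 1 = -1 := by simp [sg, ZMod.val_one]

theorem sg_add (a b : ZMod 2) : sg (a + b) = sg a * sg b := by
  revert a b
  simp [forall_zmod_two, show (1 + 1 : ZMod 2) = 0 from rfl]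

theorem sg_mul_self (a : ZMod 2) : sg a * sg a = 1 := by
  revert a
  simp [forall_zmod_two]

theorem sg_ne_zero (a : ZMod 2) : sg a ≠ 0 := fun h => by
  simpa [h] using sg_mul_self a

theorem sg_injective : Function.Injective sg := by
  intro a b
  revert a b
  norm_num [forall_zmod_two, neg_eq_iff_add_eq_zero, eq_neg_iff_add_eq_zero]

theorem sg_sum {ι : Type*} (s : Finset ι) (f : ι → ZMod 2) :
    sg (∑ i ∈ s, f i) = ∏ i ∈ s, sg (f i) := by
  classical
  induction s using Finset.induction_on with
  | empty => simp
  | insert a s ha ih => rw [Finset.sum_insert ha, Finset.prod_insert ha, sg_add, ih]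

variable {n : ℕ}

/-- The symplectic form on `Z_2^{2n}`. -/
def om (x y : Vec n) : ZMod 2 :=
  ∑ k, (x (Sum.inl k) * y (Sum.inr k) + x (Sum.inr k) * y (Sum.inl k))

theorem om_comm (x y : Vec n) : om x y = om y x :=
  Finset.sum_congr rfl fun _ _ => by ring

theorem om_self (x : Vec n) : om x x = 0 :=
  Finset.sum_eq_zero fun k _ => by rw [mul_comm]; exact CharTwo.add_self_eq_zero _

theorem om_add_left (x y z : Vec n) : om (x + y) z = om x z + om y z := by
  simp only [om, ← Finset.sum_add_distrib, Pi.add_apply]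
  exact Finset.sum_congr rfl fun _ _ => by ring

theorem om_add_right (x y z : Vec n) : om x (y + z) = om x y + om x z := by
  rw [om_comm, om_add_left, om_comm y, om_comm z]

@[simp] theorem om_zero_left (x : Vec n) : om 0 x = 0 := by simp [om]

theorem om_single_inl (x : Vec n) (k : Fin n) : om x (Pi.single (Sum.inl k) 1) = x (Sum.inr k) := by
  simp [om, Pi.single_apply]

theorem om_single_inr (x : Vec n) (k : Fin n) : om x (Pi.single (Sum.inr k) 1) = x (Sum.inl k) := by
  simp [om, Pi.single_apply]

theorem om_nondegenerate {x y : Vec n} (h : ∀ z, om x z = om y z) : x = y := by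
  funext k
  rcases k with k | k
  · simpa [om_single_inr] using h (Pi.single (Sum.inr k) 1)
  · simpa [om_single_inl] using h (Pi.single (Sum.inl k) 1)

theorem vec_add_self (x : Vec n) : x + x = 0 := by
  funext k
  exact CharTwo.add_self_eq_zero _

/-- Every linear functional on `Z_2^{2n}` is of the form `[x, ·]`. -/
theorem exists_om_eq (f : Vec n →ₗ[ZMod 2] ZMod 2) : ∃ x, ∀ y, f y = om x y := by
  refine ⟨fun k => f (Pi.single k.swap 1), fun y => ?_⟩
  conv_lhs => rw [← LinearMap.sum_single_apply (fun _ => ZMod 2) y, map_sum]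
  simp only [om, Fintype.sum_sum_type, ← Finset.sum_add_distrib]
  refine Finset.sum_congr rfl fun k _ => ?_
  have h : ∀ j, f (Pi.single j (y j)) = y j * f (Pi.single j 1) := fun j => by
    rw [← smul_eq_mul, ← map_smul, ← Pi.single_smul, smul_eq_mul, mul_one]
  rw [h, h, Sum.swap_inl, Sum.swap_inr]
  ring

/-! ### One-qubit Weyl operators -/

/-- The one-qubit Weyl operator `i^{-pq} Z^p X^q`. -/
def weylOne (p q : ZMod 2) : U2 := iI⁻¹ ^ (p.val * q.val) * (Z ^ p.val * X ^ q.val)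

theorem weylOne_apply (p q r s : ZMod 2) :
    (weylOne p q : Matrix (ZMod 2) (ZMod 2) ℂ) r s =
      (-Complex.I) ^ (p.val * q.val) * (-1) ^ (p.val * r.val) * if r = s + q then 1 else 0 := by
  have hinv : ((iI⁻¹ : U2) : Matrix (ZMod 2) (ZMod 2) ℂ) = (-Complex.I) • 1 := by
    change star (Complex.I • (1 : Matrix (ZMod 2) (ZMod 2) ℂ)) = _
    simp
  rw [weylOne, Submonoid.coe_mul, SubmonoidClass.coe_pow, hinv]
  have h2 : (1 + 1 : ZMod 2) = 0 := rfl
  revert p q r s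
  simp [forall_zmod_two, Z, X, Matrix.mul_apply, sum_zmod_two, ZMod.val_one, h2]

theorem weylOne_comm (p q p' q' : ZMod 2) :
    (weylOne p q : Matrix (ZMod 2) (ZMod 2) ℂ) * weylOne p' q' =
      sg (p * q' + q * p') • ((weylOne p' q' : Matrix (ZMod 2) (ZMod 2) ℂ) * weylOne p q) := by
  have h2 : (1 + 1 : ZMod 2) = 0 := rfl
  ext r s
  revert p q p' q' r s
  simp [forall_zmod_two, weylOne_apply, Matrix.mul_apply, ZMod.val_one, h2]

theorem weylOne_mul (p q p' q' : ZMod 2) :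
    ∃ c : ℂ, (weylOne p q : Matrix (ZMod 2) (ZMod 2) ℂ) * weylOne p' q' =
      c • (weylOne (p + p') (q + q') : Matrix (ZMod 2) (ZMod 2) ℂ) := by
  have h2 : (1 + 1 : ZMod 2) = 0 := rfl
  -- The two phases of the factors, the inverse of the phase of the product, and the sign from
  -- moving `X^q` past `Z^{p'}`.
  refine ⟨(-Complex.I) ^ (p.val * q.val) * (-Complex.I) ^ (p'.val * q'.val) *
    (Complex.I) ^ ((p + p').val * (q + q').val) * (-1) ^ (q.val * p'.val), ?_⟩
  ext r s
  revert p q p' q' r s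
  simp [forall_zmod_two, weylOne_apply, Matrix.mul_apply, ZMod.val_one, h2]

theorem weylOne_mul_self (p q : ZMod 2) : weylOne p q * weylOne p q = 1 := by
  have h2 : (1 + 1 : ZMod 2) = 0 := rfl
  apply Subtype.ext
  ext r s
  revert p q r s
  simp [forall_zmod_two, weylOne_apply, Matrix.mul_apply, ZMod.val_one, h2,
    Matrix.one_apply]

theorem exists_eq_smul_weylOne {P : U2} (hP : P ∈ pauliOne) :
    ∃ (c : ℂ) (p q : ZMod 2), (P : Matrix (ZMod 2) (ZMod 2) ℂ) = c • (weylOne p q).1 := by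
  have hinv : ∀ P : U2, P⁻¹ = star P := fun _ => rfl
  have hw : ∀ p q, (weylOne p q)⁻¹ = weylOne p q := fun p q =>
    inv_eq_of_mul_eq_one_left (weylOne_mul_self p q)
  induction hP using Subgroup.closure_induction with
  | mem x hx =>
    rcases hx with rfl | rfl | rfl
    · exact ⟨1, 0, 1, by simp [weylOne, ZMod.val_one]⟩
    · exact ⟨1, 1, 0, by simp [weylOne, ZMod.val_one]⟩
    · exact ⟨Complex.I, 0, 0, by simp [weylOne, iI]⟩
  | one => exact ⟨1, 0, 0, by simp [weylOne]⟩
  | mul x y _ _ hx hy =>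
    obtain ⟨c, p, q, hx⟩ := hx
    obtain ⟨d, p', q', hy⟩ := hy
    obtain ⟨e, he⟩ := weylOne_mul p q p' q'
    exact ⟨c * d * e, p + p', q + q', by
      rw [Submonoid.coe_mul, hx, hy, smul_mul_smul_comm, he, smul_smul]⟩
  | inv x _ hx =>
    obtain ⟨c, p, q, hx⟩ := hx
    refine ⟨star c, p, q, ?_⟩
    have : star (weylOne p q).1 = (weylOne p q).1 := congrArg Subtype.val (hw p q)
    change star x.1 = _
    rw [hx, star_smul, this]

/-! ### Weyl operators -/

/-- Square matrices acting on `n` qubits. -/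
abbrev Mat (n : ℕ) : Type := Matrix (Fin n → ZMod 2) (Fin n → ZMod 2) ℂ

theorem kron_smul (c : Fin n → ℂ) (A : Fin n → Matrix (ZMod 2) (ZMod 2) ℂ) :
    kron (fun k => c k • A k) = (∏ k, c k) • kron A := by
  ext r s
  simp [kron, Finset.prod_mul_distrib]

theorem kron_update_smul (k : Fin n) (c : ℂ) (A : Fin n → Matrix (ZMod 2) (ZMod 2) ℂ) :
    kron (Function.update A k (c • A k)) = c • kron A := by
  have h : Function.update A k (c • A k) = fun j => (if j = k then c else 1) • A j := by
    funext j
    by_cases hj : j = k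
    · subst hj; simp
    · simp [hj]
  rw [h, kron_smul]
  simp

theorem coe_weyl (x : Vec n) :
    (weyl x : Mat n) = kron fun k => (weylOne (x (Sum.inl k)) (x (Sum.inr k))).1 := rfl

theorem weyl_comm (x y : Vec n) :
    (weyl x : Mat n) * weyl y = sg (om x y) • ((weyl y : Mat n) * weyl x) := by
  rw [coe_weyl, coe_weyl, ← kron_mul, ← kron_mul, om, sg_sum, ← kron_smul]
  congr 1
  funext k
  exact weylOne_comm _ _ _ _

theorem exists_weyl_mul_eq (x y : Vec n) :
    ∃ c : ℂ, (weyl x : Mat n) * weyl y = c • (weyl (x + y) : Mat n) := by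
  choose c hc using fun k =>
    weylOne_mul (x (Sum.inl k)) (x (Sum.inr k)) (y (Sum.inl k)) (y (Sum.inr k))
  refine ⟨∏ k, c k, ?_⟩
  rw [coe_weyl, coe_weyl, ← kron_mul, coe_weyl, ← kron_smul]
  congr 1
  funext k
  exact hc k

theorem weyl_mul_self (x : Vec n) : weyl x * weyl x = 1 := by
  rw [weyl, ← map_mul, ← map_one (tensor n)]
  congr 1
  funext k
  exact weylOne_mul_self _ _

theorem coe_weyl_mul_self (x : Vec n) : (weyl x : Mat n) * weyl x = 1 :=
  congrArg Subtype.val (weyl_mul_self x)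

theorem weyl_inv (x : Vec n) : (weyl x)⁻¹ = weyl x :=
  inv_eq_of_mul_eq_one_left (weyl_mul_self x)

theorem star_weyl (x : Vec n) : star (weyl x : Mat n) = weyl x :=
  congrArg Subtype.val (weyl_inv x)

theorem coe_unitary_inv_mul (U : UN n) : ((U⁻¹ : UN n) : Mat n) * U = 1 :=
  congrArg Subtype.val (inv_mul_cancel U)

theorem coe_unitary_mul_inv (U : UN n) : (U : Mat n) * ((U⁻¹ : UN n) : Mat n) = 1 :=
  congrArg Subtype.val (mul_inv_cancel U)

theorem coe_unitary_ne_zero (U : UN n) : (U : Mat n) ≠ 0 := fun h => by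
  simpa [h] using coe_unitary_inv_mul U

theorem weyl_conj_weyl (x y : Vec n) :
    (weyl x : Mat n) * weyl y * weyl x = sg (om x y) • (weyl y : Mat n) := by
  rw [weyl_comm, smul_mul_assoc, mul_assoc, coe_weyl_mul_self, mul_one]

/-- Weyl operators of different vectors are not proportional. -/
theorem weyl_injective_of_smul {x y : Vec n} {c : ℂ} (h : (weyl x : Mat n) = c • (weyl y : Mat n)) :
    x = y := by
  -- Conjugation by `W_z` scales `W_x` and `W_y` by the signs of `[z, x]` and `[z, y]`, and
  -- proportional matrices scale alike.
  refine om_nondegenerate fun z => sg_injective ?_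
  have h1 := weyl_conj_weyl z x
  rw [h, mul_smul_comm, smul_mul_assoc, weyl_conj_weyl, smul_comm, ← h] at h1
  have h2 := smul_left_injective ℂ (coe_unitary_ne_zero (weyl x)) h1
  rw [om_comm x, om_comm y]
  exact h2.symm

theorem weyl_inl_apply (p : Fin n → ZMod 2) (r s : Fin n → ZMod 2) :
    (weyl (Sum.elim p 0) : Mat n) r s = if r = s then sg (∑ k, p k * r k) else 0 := by
  rw [coe_weyl]
  simp only [kron, Matrix.of_apply, weylOne_apply, Sum.elim_inl, Sum.elim_inr, Pi.zero_apply,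
    ZMod.val_zero, mul_zero, pow_zero, one_mul, add_zero]
  split_ifs with h
  · subst h
    rw [sg_sum]
    refine Finset.prod_congr rfl fun k _ => ?_
    generalize p k = a
    generalize r k = b
    revert a b
    simp [forall_zmod_two, ZMod.val_one]
  · obtain ⟨k, hk⟩ := Function.ne_iff.mp h
    exact Finset.prod_eq_zero (Finset.mem_univ k) (by simp [hk])

theorem weyl_inr_apply (q : Fin n → ZMod 2) (r s : Fin n → ZMod 2) :
    (weyl (Sum.elim 0 q) : Mat n) r s = if r = s + q then 1 else 0 := by
  rw [coe_weyl]
  simp only [kron, Matrix.of_apply, weylOne_apply, Sum.elim_inl, Sum.elim_inr, Pi.zero_apply,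
    ZMod.val_zero, zero_mul, pow_zero, one_mul]
  split_ifs with h
  · subst h
    simp
  · obtain ⟨k, hk⟩ := Function.ne_iff.mp h
    exact Finset.prod_eq_zero (Finset.mem_univ k) (if_neg hk)

/-- A matrix commuting with all Weyl operators is scalar. -/
theorem eq_smul_one_of_commute_weyl {M : Mat n} (h : ∀ x : Vec n, M * weyl x = weyl x * M) :
    ∃ c : ℂ, M = c • 1 := by
  refine ⟨M 0 0, ?_⟩
  ext r s
  by_cases hrs : r = s
  · subst hrs
    -- The shift by `r` carries the diagonal entry at `0` to the one at `r`.
    have h1 := congrFun (congrFun (h (Sum.elim 0 r)) r) 0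
    simp only [Matrix.mul_apply, weyl_inr_apply, mul_ite, mul_one, mul_zero, ite_mul, one_mul,
      zero_mul] at h1
    have h2 : ∀ x : Fin n → ZMod 2, r = x + r ↔ x = 0 := fun x => by
      rw [eq_comm, add_eq_right]
    simpa [h2] using h1
  · obtain ⟨k, hk⟩ := Function.ne_iff.mp hrs
    -- `Z` on a qubit `k` where `r` and `s` differ has different eigenvalues at `r` and `s`, so the
    -- entry vanishes.
    have h1 := congrFun (congrFun (h (Sum.elim (Pi.single k 1) 0)) r) s
    simp only [Matrix.mul_apply, weyl_inl_apply, mul_ite, mul_zero, ite_mul, zero_mul] at h1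
    simp only [Pi.single_apply, ite_mul, one_mul, zero_mul, Finset.sum_ite_eq,
      Finset.sum_ite_eq', Finset.mem_univ, if_true] at h1
    rw [mul_comm] at h1
    have h2 : M r s = 0 := by
      by_contra h3
      exact hk (sg_injective (mul_right_cancel₀ h3 h1)).symm
    simp [h2, hrs]

theorem exists_eq_smul_weyl {P : UN n} (hP : P ∈ pauli n) :
    ∃ (c : ℂ) (x : Vec n), (P : Mat n) = c • (weyl x : Mat n) := by
  obtain ⟨A, hA, rfl⟩ := hP
  choose c p q h using fun k => exists_eq_smul_weylOne (hA k (Set.mem_univ k))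
  refine ⟨∏ k, c k, Sum.elim p q, ?_⟩
  rw [coe_weyl, ← kron_smul]
  exact congrArg kron (funext h)

/-- A scalar multiple of a Weyl operator squaring to the identity is `±` that operator. -/
theorem exists_sg_of_mul_self {P : UN n} {c : ℂ} {x : Vec n}
    (h : (P : Mat n) = c • (weyl x : Mat n)) (hP : P * P = 1) :
    ∃ z, (P : Mat n) = sg z • (weyl x : Mat n) := by
  have h1 : (P : Mat n) * P = 1 := congrArg Subtype.val hP
  rw [h, smul_mul_smul_comm, coe_weyl_mul_self] at h1
  have h2 : c * c = 1 := by
    have := congrFun (congrFun h1 0) 0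
    simpa using this
  rcases mul_self_eq_one_iff.mp h2 with rfl | rfl
  · exact ⟨0, by simpa using h⟩
  · exact ⟨1, by simpa using h⟩

/-! ### The symplectic group as the isometry group of the symplectic form -/

theorem om_eq_dotProduct (x y : Vec n) : om x y = x ⬝ᵥ (J (Fin n) (ZMod 2) *ᵥ y) := by
  have h : ∀ a : ZMod 2, -a = a := by decide
  rw [← Sum.elim_comp_inl_inr y, J, Matrix.fromBlocks_mulVec]
  simp only [dotProduct, Fintype.sum_sum_type, om, Finset.sum_add_distrib]
  simp [h, Matrix.neg_mulVec]

theorem om_act (Γ : Sp n) (x y : Vec n) : om (act Γ x) (act Γ y) = om x y := by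
  rw [om_eq_dotProduct, om_eq_dotProduct, act, act, Matrix.dotProduct_mulVec,
    Matrix.vecMul_mulVec, ← Matrix.dotProduct_mulVec, Matrix.mulVec_mulVec, SymplecticGroup.mem_iff'.mp Γ.2]

theorem act_add (Γ : Sp n) (x y : Vec n) : act Γ (x + y) = act Γ x + act Γ y :=
  Matrix.mulVec_add _ _ _

theorem act_injective {Γ Δ : Sp n} (h : ∀ x, act Γ x = act Δ x) : Γ = Δ :=
  Subtype.ext (Matrix.mulVec_injective (funext h))

theorem act_inv_act (Γ : Sp n) (x : Vec n) : act Γ⁻¹ (act Γ x) = x := by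
  rw [← act_mul, inv_mul_cancel, act_one]

theorem act_act_inv (Γ : Sp n) (x : Vec n) : act Γ (act Γ⁻¹ x) = x := by
  rw [← act_mul, mul_inv_cancel, act_one]

theorem exists_sp_of_isometry (g : Vec n →+ Vec n) (hg : ∀ x y, om (g x) (g y) = om x y) :
    ∃ Γ : Sp n, ∀ x, act Γ x = g x := by
  let A := LinearMap.toMatrix' (AddMonoidHom.toZModLinearMap 2 g)
  have hA : ∀ x, A *ᵥ x = g x := fun x => by
    rw [← Matrix.toLin'_apply, Matrix.toLin'_toMatrix']
    rfl
  refine ⟨⟨A, SymplecticGroup.mem_iff'.mpr ?_⟩, hA⟩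
  have h : ∀ x y : Vec n, x ⬝ᵥ ((Aᵀ * J (Fin n) (ZMod 2) * A) *ᵥ y) =
      x ⬝ᵥ (J (Fin n) (ZMod 2) *ᵥ y) := fun x y => by
    rw [← om_eq_dotProduct, ← hg, ← hA, ← hA, om_eq_dotProduct, Matrix.dotProduct_mulVec (A *ᵥ x),
      Matrix.vecMul_mulVec, ← Matrix.dotProduct_mulVec, Matrix.mulVec_mulVec]
  exact Matrix.mulVec_injective (funext fun y => dotProduct_eq _ _ fun x => by
    rw [dotProduct_comm, h, dotProduct_comm])

/-- The symplectic transvection `x ↦ x + [x, v] v`. -/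
theorem exists_transvection (v : Vec n) :
    ∃ T : Sp n, ∀ x, act T x = x + om x v • v := by
  refine exists_sp_of_isometry
    { toFun := fun x => x + om x v • v
      map_zero' := by simp
      map_add' := fun x y => by rw [om_add_left, add_smul]; abel } fun x y => ?_
  have h : ∀ (a : ZMod 2) (x y : Vec n), om (a • x) y = a * om x y := fun a x y => by
    simp only [om, Finset.mul_sum, Pi.smul_apply, smul_eq_mul]
    exact Finset.sum_congr rfl fun _ _ => by ring
  change om (x + om x v • v) (y + om y v • v) = _
  rw [om_add_left, om_add_right, om_add_right, h, h, om_comm x (_ • v), om_comm v (_ • v), h, h,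
    om_self, om_comm v x, om_comm v y, mul_comm (om y v)]
  linear_combination CharTwo.add_self_eq_zero (om x v * om y v)

/-- Since `[x, Γw] = [Γx, Γw] = [x, w]`. Consequently a transvection along `Γw + w` keeps every
fixed vector of `Γ` fixed. -/
theorem om_add_act_of_fixed {Γ : Sp n} {x : Vec n} (hx : act Γ x = x) (w : Vec n) :
    om x (act Γ w + w) = 0 := by
  rw [om_add_right]
  nth_rw 1 [← hx]
  rw [om_act]
  exact CharTwo.add_self_eq_zero _

/-- The set of vectors moved by a symplectic matrix. -/
def moved (Γ : Sp n) : Finset (Vec n) := Finset.univ.filter fun x => act Γ x ≠ x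

theorem mem_moved {Γ : Sp n} {x : Vec n} : x ∈ moved Γ ↔ act Γ x ≠ x := by
  simp [moved]

theorem moved_mul_subset {T Γ : Sp n} (w : Vec n)
    (hT : ∀ x, act T x = x + om x (act Γ w + w) • (act Γ w + w)) : moved (T * Γ) ⊆ moved Γ := by
  intro x
  rw [mem_moved, mem_moved, act_mul]
  intro h hx
  rw [hx, hT, om_add_act_of_fixed hx, zero_smul, add_zero] at h
  exact h rfl

/-- The transvection along `Γu + u` sends `Γu` back to `u` when `[u, Γu] = 1`, so `u` becomes a new
fixed vector. -/
theorem moved_mul_ssubset {T Γ : Sp n} (u : Vec n) (hu : om u (act Γ u) = 1)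
    (hT : ∀ x, act T x = x + om x (act Γ u + u) • (act Γ u + u)) : moved (T * Γ) ⊂ moved Γ := by
  refine (Finset.ssubset_iff_of_subset (moved_mul_subset u hT)).mpr ⟨u, mem_moved.mpr ?_, ?_⟩
  · intro h
    rw [h, om_self] at hu
    exact zero_ne_one hu
  · rw [mem_moved, not_not, act_mul, hT, om_add_right, om_self, om_comm, hu, zero_add, one_smul,
      ← add_assoc, vec_add_self, zero_add]

/-- The symplectic group over `Z_2` is generated by transvections. -/
theorem sp_induction {P : Sp n → Prop} (one : P 1)
    (mul : ∀ T Γ : Sp n, (∃ v, ∀ x, act T x = x + om x v • v) → P Γ → P (T * Γ)) (Γ : Sp n) :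
    P Γ := by
  -- Transvections are involutions, so they can also be stripped off; the induction is on the number
  -- of moved vectors.
  have key : ∀ T Γ : Sp n, (∃ v, ∀ x, act T x = x + om x v • v) → P (T * Γ) → P Γ := by
    rintro T Γ ⟨v, hT⟩ h
    have hTT : T * T = 1 := act_injective fun x => by
      have : om (om x v • v) v = 0 := by
        rcases (by decide : ∀ a : ZMod 2, a = 0 ∨ a = 1) (om x v) with h | h <;> simp [h, om_self]
      rw [act_mul, hT, hT, om_add_left, this, add_zero, act_one, add_assoc, vec_add_self, add_zero]
    have := mul T (T * Γ) ⟨v, hT⟩ h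
    rwa [← mul_assoc, hTT, one_mul] at this
  induction hm : (moved Γ).card using Nat.strong_induction_on generalizing Γ with
  | _ m ih =>
    subst hm
    have good : ∀ Δ : Sp n, (moved Δ).card ≤ (moved Γ).card → (∃ u, om u (act Δ u) = 1) → P Δ := by
      rintro Δ hΔ ⟨u, hu⟩
      obtain ⟨T, hT⟩ := exists_transvection (act Δ u + u)
      exact key T Δ ⟨_, hT⟩
        (ih _ ((Finset.card_lt_card (moved_mul_ssubset u hu hT)).trans_le hΔ) _ rfl)
    by_cases h1 : Γ = 1
    · rwa [h1]
    by_cases h : ∃ u, om u (act Γ u) = 1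
    · exact good Γ le_rfl h
    have h0 : ∀ u, om u (act Γ u) = 0 := fun u =>
      ((by decide : ∀ a : ZMod 2, a ≠ 1 → a = 0) _ fun hu => h ⟨u, hu⟩)
    obtain ⟨w, hw⟩ : ∃ w, act Γ w ≠ w := by
      by_contra! hc
      exact h1 (act_injective fun x => by rw [hc, act_one])
    -- Here `[u, Γu]` vanishes identically. A transvection along `Γw + w` does not enlarge the moved
    -- set and creates a `u` with `[u, TΓu] = 1`, which reduces to the previous case.
    obtain ⟨T, hT⟩ := exists_transvection (act Γ w + w)
    refine key T Γ ⟨_, hT⟩ (good _ (Finset.card_le_card (moved_mul_subset w hT)) ?_)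
    obtain ⟨u, hu⟩ : ∃ u, om u (act Γ w + w) = 1 := by
      by_contra! hc
      refine hw (sub_eq_zero.mp ?_)
      have h2 : act Γ w - w = act Γ w + w := by
        funext k
        exact CharTwo.sub_eq_add _ _
      rw [h2]
      refine om_nondegenerate fun u => ?_
      rw [om_comm, om_zero_left]
      exact (by decide : ∀ a : ZMod 2, a ≠ 1 → a = 0) _ (hc u)
    refine ⟨u, ?_⟩
    -- Polarizing `[u, Γu] = 0` gives `[u, Γw] = [w, Γu]`.
    have h3 : om (act Γ u) (act Γ w + w) = om u (act Γ w + w) := by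
      have := h0 (u + w)
      rw [act_add, om_add_left, om_add_right, om_add_right, h0, h0, zero_add, add_zero,
        om_comm w] at this
      rw [om_add_right, om_add_right, om_act, eq_neg_of_add_eq_zero_right this,
        CharTwo.neg_eq, add_comm]
    have h4 : ∀ (a : ZMod 2) (x y : Vec n), a = 1 → om x (a • y) = om x y := by
      rintro _ x y rfl
      rw [one_smul]
    rw [act_mul, hT, om_add_right, h0, zero_add, h4 _ _ _ (h3.trans hu), hu]

/-! ### Conjugation of Weyl operators by Clifford unitaries -/

/-- Conjugation by a unitary, on all matrices. -/
def conj (U : UN n) (A : Mat n) : Mat n := U * A * ((U⁻¹ : UN n) : Mat n)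

theorem conj_coe (U V : UN n) : conj U V = ((U * V * U⁻¹ : UN n) : Mat n) := rfl

theorem conj_mul (U : UN n) (A B : Mat n) : conj U (A * B) = conj U A * conj U B := by
  simp only [conj, mul_assoc]
  rw [← mul_assoc ((U⁻¹ : UN n) : Mat n) (U : Mat n), coe_unitary_inv_mul, one_mul]

theorem conj_smul (U : UN n) (c : ℂ) (A : Mat n) : conj U (c • A) = c • conj U A := by
  simp [conj]

theorem conj_conj (U V : UN n) (A : Mat n) : conj U (conj V A) = conj (U * V) A := by
  simp only [conj, _root_.mul_inv_rev, Submonoid.coe_mul, mul_assoc]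

theorem conj_one (A : Mat n) : conj 1 A = A := by
  simp [conj]

theorem conj_eq_iff {U : UN n} {A B : Mat n} : conj U A = B ↔ (U : Mat n) * A = B * U := by
  constructor
  · rintro rfl
    rw [conj, mul_assoc, coe_unitary_inv_mul, mul_one]
  · intro h
    rw [conj, h, mul_assoc, coe_unitary_mul_inv, mul_one]

theorem conj_smul_unitary {U V : UN n} {c : ℂ} (h : (U : Mat n) = c • (V : Mat n)) (A : Mat n) :
    conj U A = conj V A := by
  rw [conj_eq_iff, h, smul_mul_assoc, mul_smul_comm]
  exact congrArg _ (conj_eq_iff.mp rfl)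

theorem conj_weyl_weyl (x y : Vec n) : conj (weyl x) (weyl y) = sg (om x y) • (weyl y : Mat n) := by
  rw [conj, weyl_inv, weyl_conj_weyl]

/-- `U W_x U† = (-1) ^ (f x) W_{Γ x}` for all `x`. -/
def Implements (U : UN n) (Γ : Sp n) (f : Vec n → ZMod 2) : Prop :=
  ∀ x, conj U (weyl x) = sg (f x) • (weyl (act Γ x) : Mat n)

theorem Implements.mul {U V : UN n} {Γ Δ : Sp n} {f g : Vec n → ZMod 2} (hU : Implements U Γ f)
    (hV : Implements V Δ g) : Implements (U * V) (Γ * Δ) fun x => f (act Δ x) + g x := fun x => by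
  rw [← conj_conj, hV, conj_smul, hU, smul_smul, act_mul, sg_add, mul_comm]

theorem implements_one : Implements (1 : UN n) 1 0 := fun x => by
  simp [conj_one, act_one]

theorem implements_weyl (y : Vec n) : Implements (weyl y) 1 (om y) := fun x => by
  rw [conj_weyl_weyl, act_one]

theorem sg_smul_weyl_inj {a b : ZMod 2} {x y : Vec n}
    (h : sg a • (weyl x : Mat n) = sg b • (weyl y : Mat n)) : x = y ∧ a = b := by
  have hxy : x = y := by
    refine weyl_injective_of_smul (c := sg a * sg b) ?_
    rw [mul_smul, ← h, smul_smul, sg_mul_self, one_smul]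
  subst hxy
  exact ⟨rfl, sg_injective (smul_left_injective ℂ (coe_unitary_ne_zero _) h)⟩

theorem Implements.unique {U : UN n} {Γ Δ : Sp n} {f g : Vec n → ZMod 2} (h : Implements U Γ f)
    (h' : Implements U Δ g) : Γ = Δ ∧ f = g := by
  have key := fun x => sg_smul_weyl_inj ((h x).symm.trans (h' x))
  exact ⟨act_injective fun x => (key x).1, funext fun x => (key x).2⟩

/-- On fixed vectors the same scalar `c` in `W_x W_y = c W_{x+y}` occurs before and after
conjugation, and cancels. For general vectors the two scalars may differ. -/
theorem Implements.apply_add {U : UN n} {Γ : Sp n} {f : Vec n → ZMod 2} (h : Implements U Γ f)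
    {x y : Vec n} (hx : act Γ x = x) (hy : act Γ y = y) : f (x + y) = f x + f y := by
  obtain ⟨c, hc⟩ := exists_weyl_mul_eq x y
  have h1 := congrArg (conj U) hc
  rw [conj_mul, conj_smul, h, h, h, act_add, hx, hy, smul_mul_smul_comm, hc, smul_smul, smul_smul,
    ← sg_add] at h1
  have h2 := smul_left_injective ℂ (coe_unitary_ne_zero _) h1
  have hc0 : c ≠ 0 := by
    rintro rfl
    rw [zero_smul] at hc
    exact coe_unitary_ne_zero (weyl x * weyl y) hc
  rw [mul_comm c] at h2
  exact (sg_injective (mul_right_cancel₀ hc0 h2)).symm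

/-- A unitary that fixes every Weyl operator is a phase. -/
theorem Implements.eq_smul_one {U : UN n} (h : Implements U 1 0) : ∃ c : ℂ, (U : Mat n) = c • 1 :=
  eq_smul_one_of_commute_weyl fun x => conj_eq_iff.mp (by simpa [act_one] using h x)

/-- A conjugate of `W_x` is a Pauli element of square `1`, hence `±` a Weyl operator. Comparing
products makes the induced map on labels additive, and comparing commutation signs makes it an
isometry. -/
theorem exists_implements {U : UN n} (hU : U ∈ cliff n) : ∃ Γ f, Implements U Γ f := by
  have h : ∀ x : Vec n, ∃ (z : ZMod 2) (y : Vec n), conj U (weyl x) = sg z • (weyl y : Mat n) := by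
    intro x
    have hx : U * weyl x * U⁻¹ ∈ pauli n := (Subgroup.mem_normalizer_iff.mp hU _).mp
      (weyl_mem_pauli x)
    obtain ⟨c, y, hy⟩ := exists_eq_smul_weyl hx
    obtain ⟨z, hz⟩ := exists_sg_of_mul_self hy (by
      rw [← MulAut.conj_apply, ← map_mul, weyl_mul_self, map_one])
    exact ⟨z, y, hz⟩
  choose f g h using h
  have hadd : ∀ x y, g (x + y) = g x + g y := fun x y => by
    obtain ⟨c, hc⟩ := exists_weyl_mul_eq x y
    obtain ⟨d, hd⟩ := exists_weyl_mul_eq (g x) (g y)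
    have hd0 : sg (f x) * sg (f y) * d ≠ 0 := by
      refine mul_ne_zero (mul_ne_zero (sg_ne_zero _) (sg_ne_zero _)) ?_
      rintro rfl
      rw [zero_smul] at hd
      exact coe_unitary_ne_zero (weyl (g x) * weyl (g y)) hd
    have h1 := congrArg (conj U) hc
    rw [conj_mul, conj_smul, h, h, h, smul_mul_smul_comm, hd, smul_smul, smul_smul] at h1
    refine (weyl_injective_of_smul (c := (sg (f x) * sg (f y) * d)⁻¹ * (c * sg (f (x + y)))) ?_).symm
    rw [mul_smul, ← h1, inv_smul_smul₀ hd0]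
  have hom : ∀ x y, om (g x) (g y) = om x y := fun x y => by
    have h1 := congrArg (conj U) (weyl_comm x y)
    rw [conj_smul, conj_mul, conj_mul, h, h, smul_mul_smul_comm, smul_mul_smul_comm, weyl_comm,
      mul_comm (sg (f y)), smul_comm (sg (om x y))] at h1
    have h2 := smul_right_injective (Mat n)
      (mul_ne_zero (sg_ne_zero (f x)) (sg_ne_zero (f y))) h1
    exact sg_injective (smul_left_injective ℂ (coe_unitary_ne_zero (weyl (g y) * weyl (g x))) h2)
  obtain ⟨Γ, hΓ⟩ := exists_sp_of_isometry (AddMonoidHom.mk' g hadd) hom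
  exact ⟨Γ, f, fun x => by rw [h, hΓ]; rfl⟩

/-! ### Transvections come from Clifford unitaries -/

/-- The phase `i` is absorbed in the tensor factor `k`. A qubit is needed: for `n = 0` the Pauli
group is trivial. -/
theorem mem_pauli_of_eq_I_smul (k : Fin n) {P Q : UN n} (hQ : Q ∈ pauli n)
    (h : (P : Mat n) = Complex.I • (Q : Mat n)) : P ∈ pauli n := by
  obtain ⟨A, hA, rfl⟩ := hQ
  refine ⟨Function.update A k (iI * A k), fun j _ => ?_, Subtype.ext ?_⟩
  · by_cases hj : j = k
    · subst hj
      rw [Function.update_self]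
      exact mul_mem (Subgroup.subset_closure (by simp)) (hA j trivial)
    · rw [Function.update_of_ne hj]
      exact hA j trivial
  · rw [h]
    refine Eq.trans ?_ (kron_update_smul k Complex.I fun j => (A j).1)
    refine congrArg kron (funext fun j => ?_)
    by_cases hj : j = k
    · subst hj
      simp [iI]
    · simp [hj]

theorem mem_pauli_of_eq_smul (k : Fin n) {P Q : UN n} (hQ : Q ∈ pauli n) {e : ℂ}
    (he : e = Complex.I ∨ e = -Complex.I) (h : (P : Mat n) = e • (Q : Mat n)) : P ∈ pauli n := by
  rcases he with rfl | rfl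
  · exact mem_pauli_of_eq_I_smul k hQ h
  · refine inv_inv P ▸ inv_mem (mem_pauli_of_eq_I_smul k (inv_mem hQ) ?_)
    change star P.1 = Complex.I • star Q.1
    rw [h, star_smul]
    simp

/-- The matrix `(1 + e W_v) / √2`. -/
def rotMat (e : ℂ) (v : Vec n) : Mat n := ((Real.sqrt 2 : ℝ) : ℂ)⁻¹ • (1 + e • (weyl v : Mat n))

theorem rotMat_mul (a b : ℂ) (v : Vec n) :
    rotMat a v * rotMat b v = (1 / 2 : ℂ) • ((1 + a * b) • 1 + (a + b) • (weyl v : Mat n)) := by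
  have h2 : ((Real.sqrt 2 : ℝ) : ℂ)⁻¹ * ((Real.sqrt 2 : ℝ) : ℂ)⁻¹ = 1 / 2 := by
    rw [← mul_inv, ← Complex.ofReal_mul, Real.mul_self_sqrt (by norm_num)]
    norm_num
  rw [rotMat, rotMat, smul_mul_smul_comm, h2, add_mul, mul_add, one_mul, one_mul, mul_add, mul_one,
    smul_mul_smul_comm, coe_weyl_mul_self]
  congr 1
  module

theorem rotMat_mul_neg {e : ℂ} (he : e * e = -1) (v : Vec n) : rotMat e v * rotMat (-e) v = 1 := by
  rw [rotMat_mul, mul_neg, he]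
  module

/-- The unitary `(1 + e W_v) / √2` for `e = ± i`. -/
def rot (e : ℂ) (he : e = Complex.I ∨ e = -Complex.I) (v : Vec n) : UN n :=
  ⟨rotMat e v, by
    have h1 : e * e = -1 := by rcases he with rfl | rfl <;> simp
    have h2 : star e = -e := by rcases he with rfl | rfl <;> simp
    have h3 : star (rotMat e v) = rotMat (-e) v := by
      rw [rotMat, star_smul, star_add, star_smul, star_weyl, h2, star_one, star_inv₀,
        Complex.star_def, Complex.conj_ofReal, rotMat]
    rw [Matrix.mem_unitaryGroup_iff, h3, rotMat_mul_neg h1]⟩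

theorem rot_inv {e : ℂ} (he : e = Complex.I ∨ e = -Complex.I) (he' : -e = Complex.I ∨ -e = -Complex.I)
    (v : Vec n) : (rot e he v)⁻¹ = rot (-e) he' v := by
  refine inv_eq_of_mul_eq_one_right (Subtype.ext (rotMat_mul_neg ?_ v))
  rcases he with rfl | rfl <;> simp

/-- Moving `W_x` across `(1 + e W_v)/√2` leaves it unchanged or inverts it, according to `[x, v]`;
in the second case the square of the inverse, `-e W_v`, is left over. -/
theorem conj_rot {e : ℂ} (he : e = Complex.I ∨ e = -Complex.I) (v x : Vec n) :
    conj (rot e he v) (weyl x) =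
      if om x v = 0 then (weyl x : Mat n) else -e • ((weyl x : Mat n) * weyl v) := by
  have h1 : e * e = -1 := by rcases he with rfl | rfl <;> simp
  have h2 : rotMat e v * weyl x = weyl x * rotMat (e * sg (om x v)) v := by
    rw [rotMat, smul_mul_assoc, add_mul, smul_mul_assoc, weyl_comm v x, rotMat, mul_smul_comm,
      mul_add, mul_smul_comm, one_mul, mul_one, smul_smul, om_comm]
  rw [conj_eq_iff]
  change rotMat e v * weyl x = _ * rotMat e v
  rw [h2]
  split_ifs with h
  · rw [h, sg_zero, mul_one]
  · have h' : om x v = 1 := (by decide : ∀ a : ZMod 2, a ≠ 0 → a = 1) _ h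
    have h3 : rotMat (-e) v * rotMat (-e) v = -e • (weyl v : Mat n) := by
      rw [rotMat_mul, neg_mul_neg, h1]
      module
    have h4 := rotMat_mul_neg (e := -e) (by simpa using h1) v
    rw [neg_neg] at h4
    rw [h', sg_one, mul_neg_one, ← mul_smul_comm, ← h3, mul_assoc, mul_assoc, h4, mul_one]

theorem rot_conj_mem_pauli {e : ℂ} (he : e = Complex.I ∨ e = -Complex.I) (v : Vec n) {P : UN n}
    (hP : P ∈ pauli n) : rot e he v * P * (rot e he v)⁻¹ ∈ pauli n := by
  obtain ⟨c, x, hx⟩ := exists_eq_smul_weyl hP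
  have h1 := conj_rot he v x
  have h2 := conj_coe (rot e he v) P
  rw [hx, conj_smul, h1] at h2
  split_ifs at h2 with h
  · rwa [← Subtype.ext (hx.trans h2)]
  -- A nonzero `[x, v]` forces the existence of a qubit, which can carry the phase `-e`.
  · obtain ⟨k, -, -⟩ : ∃ k : Fin n, k ∈ Finset.univ ∧
        (x (Sum.inl k) * v (Sum.inr k) + x (Sum.inr k) * v (Sum.inl k)) ≠ 0 :=
      Finset.exists_ne_zero_of_sum_ne_zero h
    have he' : -e = Complex.I ∨ -e = -Complex.I := by
      rcases he with rfl | rfl <;> simp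
    refine mem_pauli_of_eq_smul k (mul_mem hP (weyl_mem_pauli v)) he' ?_
    rw [← h2, smul_comm, ← smul_mul_assoc, ← hx]
    rfl

theorem rot_mem_cliff {e : ℂ} (he : e = Complex.I ∨ e = -Complex.I) (v : Vec n) :
    rot e he v ∈ cliff n := by
  have he' : -e = Complex.I ∨ -e = -Complex.I := by
    rcases he with rfl | rfl <;> simp
  refine Subgroup.mem_normalizer_iff.mpr fun P => ⟨rot_conj_mem_pauli he v, fun h => ?_⟩
  have h1 := rot_conj_mem_pauli he' v h
  rw [← rot_inv he he'] at h1
  simpa [mul_assoc] using h1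

/-- Every symplectic matrix is implemented by a Clifford unitary. -/
theorem exists_cliff_implements (Γ : Sp n) : ∃ U ∈ cliff n, ∃ f, Implements U Γ f := by
  induction Γ using sp_induction with
  | one => exact ⟨1, one_mem _, _, implements_one⟩
  | mul T Γ hT hΓ =>
    obtain ⟨v, hT⟩ := hT
    obtain ⟨U, hU, f, hf⟩ := hΓ
    have hR := rot_mem_cliff (Or.inl rfl) v
    obtain ⟨Δ, g, hg⟩ := exists_implements hR
    -- Up to a scalar, the rotation takes `W_x` to `W_x` or to `W_x W_v`, that is to `W_{x +
    -- [x,v]v}`.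
    have hΔ : T = Δ := act_injective fun x => by
      have h1 := (hg x).symm.trans (conj_rot (Or.inl rfl) v x)
      rw [hT]
      split_ifs at h1 with h
      · rw [h, zero_smul, add_zero]
        refine (sg_smul_weyl_inj (a := g x) (b := 0) ?_).1.symm
        rw [h1, sg_zero, one_smul]
      · rw [(by decide : ∀ a : ZMod 2, a ≠ 0 → a = 1) _ h, one_smul]
        obtain ⟨c, hc⟩ := exists_weyl_mul_eq x v
        rw [hc, smul_smul] at h1
        refine (weyl_injective_of_smul (c := sg (g x) * (-Complex.I * c)) ?_).symm
        rw [mul_smul, ← h1, smul_smul, sg_mul_self, one_smul]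
    exact ⟨_, mul_mem hR hU, _, hΔ ▸ hg.mul hf⟩

/-! ### The extension `Z_2^{2n} → C_n → Sp(2n, 2)` -/

theorem mk_eq_mk_of_eq_smul {U V : cliff n} {c : ℂ} (h : ((U : UN n) : Mat n) = c • ((V : UN n) : Mat n)) :
    (QuotientGroup.mk U : ProjClifford n) = QuotientGroup.mk V := by
  refine (QuotientGroup.eq.mpr (show V⁻¹ * U ∈ phases n from ⟨c, ?_⟩)).symm
  change ((V⁻¹ : UN n) : Mat n) * ((U : UN n) : Mat n) = c • 1
  rw [h, mul_smul_comm, coe_unitary_inv_mul]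

theorem exists_eq_smul_of_mk_eq_mk {U V : cliff n}
    (h : (QuotientGroup.mk U : ProjClifford n) = QuotientGroup.mk V) :
    ∃ c : ℂ, ((U : UN n) : Mat n) = c • ((V : UN n) : Mat n) := by
  obtain ⟨c, hc⟩ := QuotientGroup.eq.mp h.symm
  refine ⟨c, ?_⟩
  change ((V⁻¹ : UN n) : Mat n) * ((U : UN n) : Mat n) = c • 1 at hc
  have h1 := congrArg (((V : UN n) : Mat n) * ·) hc
  simpa only [← mul_assoc, coe_unitary_mul_inv, one_mul, mul_smul_comm, mul_one] using h1

/-- `U W_x U† = (-1) ^ (f x) W_{Γ x}` for all `x` and all representatives `U` of `c`. -/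
def ClassImplements (c : ProjClifford n) (Γ : Sp n) (f : Vec n → ZMod 2) : Prop :=
  ∀ U : cliff n, (QuotientGroup.mk U : ProjClifford n) = c → Implements (U : UN n) Γ f

theorem Implements.mk {U : cliff n} {Γ : Sp n} {f : Vec n → ZMod 2} (h : Implements (U : UN n) Γ f) :
    ClassImplements (QuotientGroup.mk U) Γ f := fun V hV x => by
  obtain ⟨c, hc⟩ := exists_eq_smul_of_mk_eq_mk hV
  rw [conj_smul_unitary hc, h]

theorem exists_classImplements (c : ProjClifford n) :
    ∃ p : Sp n × (Vec n → ZMod 2), ClassImplements c p.1 p.2 := by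
  induction c using QuotientGroup.induction_on with
  | H U =>
    obtain ⟨Γ, f, h⟩ := exists_implements U.2
    exact ⟨(Γ, f), h.mk⟩

/-- The sign `(-1) ^ (sgn c x)` in `U W_x U† = ± W_{Γ x}`. -/
def sgn (c : ProjClifford n) : Vec n → ZMod 2 := (exists_classImplements c).choose.2

theorem ClassImplements.unique {c : ProjClifford n} {Γ Δ : Sp n} {f g : Vec n → ZMod 2}
    (h : ClassImplements c Γ f) (h' : ClassImplements c Δ g) : Γ = Δ ∧ f = g := by
  induction c using QuotientGroup.induction_on with
  | H U => exact (h U rfl).unique (h' U rfl)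

theorem ClassImplements.mul {c d : ProjClifford n} {Γ Δ : Sp n} {f g : Vec n → ZMod 2}
    (h : ClassImplements c Γ f) (h' : ClassImplements d Δ g) :
    ClassImplements (c * d) (Γ * Δ) fun x => f (act Δ x) + g x := by
  induction c using QuotientGroup.induction_on with
  | H U =>
    induction d using QuotientGroup.induction_on with
    | H V => exact ((h U rfl).mul (h' V rfl)).mk (U := U * V)

theorem classImplements_one : ClassImplements (1 : ProjClifford n) 1 0 :=
  implements_one.mk (U := 1)

/-- The projection `C_n → Sp(2n, 2)`. -/
def proj : ProjClifford n →* Sp n where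
  toFun c := (exists_classImplements c).choose.1
  map_one' := ((exists_classImplements (1 : ProjClifford n)).choose_spec.unique classImplements_one).1
  map_mul' c d := ((exists_classImplements (c * d)).choose_spec.unique
    ((exists_classImplements c).choose_spec.mul (exists_classImplements d).choose_spec)).1

theorem classImplements (c : ProjClifford n) : ClassImplements c (proj c) (sgn c) :=
  (exists_classImplements c).choose_spec

theorem sgn_mul (c d : ProjClifford n) (x : Vec n) :
    sgn (c * d) x = sgn c (act (proj d) x) + sgn d x :=
  congrFun ((classImplements (c * d)).unique ((classImplements c).mul (classImplements d))).2 x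

theorem sgn_add_of_fixed (c : ProjClifford n) {x y : Vec n} (hx : act (proj c) x = x)
    (hy : act (proj c) y = y) : sgn c (x + y) = sgn c x + sgn c y := by
  obtain ⟨U, hU⟩ := QuotientGroup.mk_surjective c
  exact (classImplements c U hU).apply_add hx hy

theorem weylClass_implements (x : Vec n) : ClassImplements (weylClass x) 1 (om x) :=
  (implements_weyl x).mk (U := ⟨weyl x, _⟩)

@[simp] theorem proj_weylClass (x : Vec n) : proj (weylClass x) = 1 :=
  ((classImplements _).unique (weylClass_implements x)).1

@[simp] theorem sgn_weylClass (x y : Vec n) : sgn (weylClass x) y = om x y :=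
  congrFun ((classImplements _).unique (weylClass_implements x)).2 y

theorem weylClass_add (x y : Vec n) : weylClass (x + y) = weylClass x * weylClass y := by
  obtain ⟨c, hc⟩ := exists_weyl_mul_eq x y
  exact (mk_eq_mk_of_eq_smul (U := ⟨weyl x * weyl y, _⟩) hc).symm

@[simp] theorem weylClass_zero : weylClass (0 : Vec n) = 1 := by
  have h := weylClass_add (0 : Vec n) 0
  rwa [add_zero, left_eq_mul] at h

theorem weylClass_injective : Function.Injective (weylClass (n := n)) := fun x y h => by
  obtain ⟨c, hc⟩ := exists_eq_smul_of_mk_eq_mk h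
  exact weyl_injective_of_smul hc

/-- Signs are phases, so they disappear in the projective group. -/
theorem mul_weylClass (c : ProjClifford n) (x : Vec n) :
    c * weylClass x = weylClass (act (proj c) x) * c := by
  obtain ⟨U, rfl⟩ := QuotientGroup.mk_surjective c
  rw [← mul_inv_eq_iff_eq_mul]
  exact mk_eq_mk_of_eq_smul (U := U * ⟨weyl x, _⟩ * U⁻¹)
    (V := ⟨weyl (act (proj (QuotientGroup.mk U)) x), _⟩) (classImplements _ U rfl x)

theorem eq_one_of_sgn_eq_zero {c : ProjClifford n} (h1 : proj c = 1) (h2 : sgn c = 0) : c = 1 := by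
  obtain ⟨U, rfl⟩ := QuotientGroup.mk_surjective c
  have h := classImplements _ U rfl
  rw [h1, h2] at h
  obtain ⟨c, hc⟩ := h.eq_smul_one
  exact mk_eq_mk_of_eq_smul (V := 1) hc

/-- A sign function on a space of fixed vectors is given by a Weyl operator. -/
theorem exists_sgn_eq_om (c : ProjClifford n) :
    ∃ y, ∀ x, act (proj c) x = x → sgn c x = om y x := by
  let F : Submodule (ZMod 2) (Vec n) :=
    AddSubgroup.toZModSubmodule 2
      { carrier := {x | act (proj c) x = x}
        add_mem' := fun {x y} hx hy => by
          rw [Set.mem_ofPred_eq] at *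
          rw [act_add, hx, hy]
        zero_mem' := by simp [act]
        neg_mem' := fun {x} hx => by
          rw [Set.mem_ofPred_eq] at *
          rw [neg_eq_of_add_eq_zero_left (vec_add_self x), hx] }
  let f : F →ₗ[ZMod 2] ZMod 2 := AddMonoidHom.toZModLinearMap 2
    (AddMonoidHom.mk' (fun x : F => sgn c x) fun x y => sgn_add_of_fixed c x.2 y.2)
  obtain ⟨g, hg⟩ := f.exists_extend
  obtain ⟨y, hy⟩ := exists_om_eq g
  refine ⟨y, fun x hx => ?_⟩
  rw [← hy]
  exact (LinearMap.congr_fun hg ⟨x, hx⟩).symm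

/-- The kernel of `proj` consists of Weyl classes: over `1` every vector is fixed, so the sign
function of `c d⁻¹` is some `[y, ·]`, which `W_y` cancels. -/
theorem exists_eq_weylClass_mul {c d : ProjClifford n} (h : proj c = proj d) :
    ∃ x, c = weylClass x * d := by
  have h1 : proj (c * d⁻¹) = 1 := by rw [map_mul, map_inv, h, mul_inv_cancel]
  obtain ⟨y, hy⟩ := exists_sgn_eq_om (c * d⁻¹)
  refine ⟨y, ?_⟩
  rw [← mul_inv_eq_iff_eq_mul]
  have h2 : weylClass y * (c * d⁻¹) = 1 := by
    refine eq_one_of_sgn_eq_zero (by rw [map_mul, h1, proj_weylClass, one_mul]) (funext fun x => ?_)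
    rw [sgn_mul, h1, act_one, sgn_weylClass, hy x (by rw [h1, act_one])]
    exact CharTwo.add_self_eq_zero _
  have h3 : weylClass y * weylClass y = 1 := by
    rw [← weylClass_add, vec_add_self, weylClass_zero]
  exact mul_left_cancel (h2.trans h3.symm)

theorem proj_surjective : Function.Surjective (proj (n := n)) := fun Γ => by
  obtain ⟨U, hU, f, hf⟩ := exists_cliff_implements Γ
  exact ⟨QuotientGroup.mk ⟨U, hU⟩, ((classImplements _).unique (hf.mk (U := ⟨U, hU⟩))).1⟩

/-! ### Adapted sections -/

theorem proj_eq_of_liesOver {c : ProjClifford n} {Γ : Sp n} (h : LiesOver c Γ) : proj c = Γ := by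
  obtain ⟨U, hU⟩ := QuotientGroup.mk_surjective c
  refine act_injective fun x => ?_
  have h1 := classImplements c U hU x
  rw [conj_coe] at h1
  rcases h U hU x with h2 | h2
  · rw [h2] at h1
    exact (sg_smul_weyl_inj (a := 0) (by simpa using h1)).1.symm
  · rw [h2] at h1
    exact (sg_smul_weyl_inj (a := 1) (by rw [← h1, sg_one, neg_one_smul]; rfl)).1.symm

theorem liesOver_proj (c : ProjClifford n) : LiesOver c (proj c) := fun U hU x => by
  have h1 := classImplements c U hU x
  rw [conj_coe] at h1
  rcases (by decide : ∀ a : ZMod 2, a = 0 ∨ a = 1) (sgn c x) with h | h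
  · exact Or.inl (Subtype.ext (by simpa [h] using h1))
  · exact Or.inr (Subtype.ext (by rw [h1, h, sg_one, neg_one_smul]; rfl))

theorem IsAdaptedSection.proj_eq {t : Sp n → ProjClifford n} (ht : IsAdaptedSection t) (Γ : Sp n) :
    proj (t Γ) = Γ :=
  proj_eq_of_liesOver (ht.liesOver Γ)

theorem IsAdaptedSection.sgn_eq_zero {t : Sp n → ProjClifford n} (ht : IsAdaptedSection t)
    {Γ : Sp n} {v : Vec n} (hv : act Γ v = v) : sgn (t Γ) v = 0 := by
  obtain ⟨U, hU⟩ := QuotientGroup.mk_surjective (t Γ)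
  have h1 := classImplements _ U hU v
  rw [conj_coe, ht.fixes Γ v hv U hU] at h1
  exact (sg_smul_weyl_inj (a := 0) (by simpa using h1)).2.symm

theorem exists_isAdaptedSection (n : ℕ) : ∃ t : Sp n → ProjClifford n, IsAdaptedSection t := by
  have h : ∀ Γ : Sp n, ∃ c, proj c = Γ ∧ ∀ v, act Γ v = v → sgn c v = 0 := fun Γ => by
    obtain ⟨c, rfl⟩ := proj_surjective Γ
    obtain ⟨y, hy⟩ := exists_sgn_eq_om c
    -- Any lift `c` is corrected by the Weyl class whose sign agrees with `sgn c` on the fixed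
    -- space.
    refine ⟨weylClass y * c, by simp, fun v hv => ?_⟩
    rw [sgn_mul, sgn_weylClass, hv, hy v hv]
    exact CharTwo.add_self_eq_zero _
  choose t ht hs using h
  refine ⟨t, fun Γ => ?_, ?_, fun Γ v hv U hU => ?_⟩
  · simpa only [ht] using liesOver_proj (t Γ)
  · exact eq_one_of_sgn_eq_zero (ht 1) (funext fun v => hs 1 v (act_one v))
  · have h1 := classImplements _ U hU v
    rw [ht, hv, hs Γ v hv, sg_zero, one_smul] at h1
    exact Subtype.ext h1

theorem phi_bijective {t : Sp n → ProjClifford n} (ht : IsAdaptedSection t) :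
    Function.Bijective (phi t) := by
  refine ⟨fun r s h => ?_, fun c => ?_⟩
  · have h1 := congrArg proj h
    simp only [phi, map_mul, proj_weylClass, one_mul, ht.proj_eq] at h1
    simp only [phi, h1, mul_left_inj] at h
    exact SemidirectProduct.ext (Multiplicative.toAdd.injective (weylClass_injective h)) h1
  · obtain ⟨x, hx⟩ := exists_eq_weylClass_mul (ht.proj_eq (proj c)).symm
    exact ⟨⟨Multiplicative.ofAdd x, proj c⟩, hx.symm⟩

/-! ### The group algebra of the projective Clifford group -/

/-- The group algebra `ℂ[C_n]`. -/
abbrev CliffAlg (n : ℕ) : Type := MonoidAlgebra ℂ (ProjClifford n)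

/-- The basis element of `ℂ[C_n]` attached to `c`. -/
def dl : ProjClifford n →* CliffAlg n := MonoidAlgebra.of ℂ (ProjClifford n)

/-- The idempotent of `ℂ[C_n]` for the character `[·, a]` of `Z_2^{2n}`. -/
def idem (a : Vec n) : CliffAlg n :=
  (Fintype.card (Vec n) : ℂ)⁻¹ • ∑ x : Vec n, sg (om x a) • dl (weylClass x)

theorem dl_weylClass_mul_idem (x a : Vec n) :
    dl (weylClass x) * idem a = sg (om x a) • idem a := by
  rw [idem, mul_smul_comm, smul_comm, Finset.mul_sum]
  congr 1
  rw [Finset.smul_sum]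
  refine Fintype.sum_equiv (Equiv.addLeft x) _ _ fun y => ?_
  rw [Equiv.coe_addLeft, om_add_left, sg_add, smul_smul, ← mul_assoc, sg_mul_self, one_mul,
    weylClass_add, map_mul, mul_smul_comm]

/-- Conjugation by `c` permutes the Weyl classes by an isometry, hence permutes the characters `[·,
a]` in the same way. -/
theorem dl_mul_idem (c : ProjClifford n) (a : Vec n) :
    dl c * idem a = idem (act (proj c) a) * dl c := by
  rw [idem, idem, mul_smul_comm, smul_mul_assoc, Finset.mul_sum, Finset.sum_mul]
  congr 1
  refine Fintype.sum_equiv ⟨act (proj c), act (proj c)⁻¹, act_inv_act _, act_act_inv _⟩ _ _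
    fun y => ?_
  rw [Equiv.coe_fn_mk, om_act, mul_smul_comm, smul_mul_assoc, ← map_mul, mul_weylClass, map_mul]

theorem idem_mul_dl_weylClass (x a : Vec n) :
    idem a * dl (weylClass x) = sg (om x a) • idem a := by
  rw [← dl_weylClass_mul_idem, dl_mul_idem, proj_weylClass, act_one]

theorem idem_mul_idem_of_ne {a b : Vec n} (h : a ≠ b) : idem a * idem b = 0 := by
  obtain ⟨x, hx⟩ : ∃ x, om x a ≠ om x b := by
    by_contra! hc
    exact h (om_nondegenerate fun z => by rw [om_comm, hc, om_comm])
  have h1 : sg (om x a) • (idem a * idem b) = sg (om x b) • (idem a * idem b) := by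
    rw [← smul_mul_assoc, ← idem_mul_dl_weylClass, mul_assoc, dl_weylClass_mul_idem, mul_smul_comm]
  by_contra h2
  exact hx (sg_injective (smul_left_injective ℂ h2 h1))

theorem card_vec_ne_zero : (Fintype.card (Vec n) : ℂ) ≠ 0 :=
  Nat.cast_ne_zero.mpr Fintype.card_ne_zero

theorem idem_mul_self (a : Vec n) : idem a * idem a = idem a := by
  nth_rw 1 [idem]
  rw [smul_mul_assoc, Finset.sum_mul]
  simp only [smul_mul_assoc, dl_weylClass_mul_idem, smul_smul, sg_mul_self, one_smul]
  rw [Finset.sum_const, Finset.card_univ, ← Nat.cast_smul_eq_nsmul ℂ, smul_smul,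
    inv_mul_cancel₀ card_vec_ne_zero, one_smul]

theorem sum_sg_om {x : Vec n} (hx : x ≠ 0) : ∑ a, sg (om x a) = 0 := by
  obtain ⟨y, hy⟩ : ∃ y, om x y = 1 := by
    by_contra! hc
    exact hx (om_nondegenerate fun z => by
      rw [om_zero_left]
      exact (by decide : ∀ a : ZMod 2, a ≠ 1 → a = 0) _ (hc z))
  have h : ∑ a, sg (om x a) = -∑ a, sg (om x a) := by
    rw [← Finset.sum_neg_distrib]
    refine Fintype.sum_equiv (Equiv.addLeft y) _ _ fun a => ?_
    rw [Equiv.coe_addLeft, om_add_right, sg_add, hy, sg_one, neg_one_mul, neg_neg]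
  exact self_eq_neg.mp h

theorem sum_idem : ∑ a : Vec n, idem a = 1 := by
  simp only [idem]
  rw [← Finset.smul_sum, Finset.sum_comm]
  simp only [← Finset.sum_smul]
  rw [Finset.sum_eq_single 0]
  · simp only [om_zero_left, sg_zero, Finset.sum_const, Finset.card_univ, nsmul_eq_mul, mul_one,
      weylClass_zero, map_one]
    rw [smul_smul, inv_mul_cancel₀ card_vec_ne_zero, one_smul]
  · intro x _ hx
    rw [sum_sg_om hx, zero_smul]
  · exact fun h => absurd (Finset.mem_univ _) h

/-- The element `∑_a ± c e_a` of `ℂ[C_n]`, where the sign is that in `c W_a c⁻¹ = ± W_{Γ a}`. -/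
def signed (c : ProjClifford n) : CliffAlg n := ∑ a, sg (sgn c a) • (dl c * idem a)

theorem signed_mul_idem (c : ProjClifford n) (a : Vec n) :
    signed c * idem a = sg (sgn c a) • (dl c * idem a) := by
  rw [signed, Finset.sum_mul, Finset.sum_eq_single a]
  · rw [smul_mul_assoc, mul_assoc, idem_mul_self]
  · intro b _ hb
    rw [smul_mul_assoc, mul_assoc, idem_mul_idem_of_ne hb, mul_zero, smul_zero]
  · exact fun h => absurd (Finset.mem_univ _) h

/-- As `d e_a = e_{Γa} d` with `Γ = proj d`, the left factor contributes its sign at `Γa`, which is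
what the cocycle rule `sgn_mul` requires. -/
theorem signed_mul (c d : ProjClifford n) : signed (c * d) = signed c * signed d := by
  rw [signed, signed.eq_1 d, Finset.mul_sum]
  refine Finset.sum_congr rfl fun a _ => ?_
  rw [mul_smul_comm, dl_mul_idem d, ← mul_assoc, signed_mul_idem, smul_mul_assoc, smul_smul,
    mul_assoc, ← dl_mul_idem, ← mul_assoc, ← map_mul, sgn_mul, sg_add, mul_comm]

theorem signed_weylClass (x : Vec n) : signed (weylClass x) = 1 := by
  simp only [signed, sgn_weylClass, dl_weylClass_mul_idem, smul_smul, sg_mul_self, one_smul,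
    sum_idem]

theorem signed_eq_of_proj_eq {c d : ProjClifford n} (h : proj c = proj d) :
    signed c = signed d := by
  obtain ⟨x, rfl⟩ := exists_eq_weylClass_mul h
  rw [signed_mul, signed_weylClass, one_mul]

theorem signed_one : signed (1 : ProjClifford n) = 1 := by
  rw [← weylClass_zero, signed_weylClass]

theorem signed_mul_dl_weylClass (c : ProjClifford n) (x : Vec n) :
    signed c * dl (weylClass x) = dl (weylClass (act (proj c) x)) * signed c := by
  rw [signed, Finset.sum_mul, Finset.mul_sum]
  refine Finset.sum_congr rfl fun a _ => ?_
  rw [smul_mul_assoc, mul_smul_comm, mul_assoc, idem_mul_dl_weylClass, ← dl_weylClass_mul_idem,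
    ← mul_assoc, ← map_mul, mul_weylClass, map_mul, mul_assoc]

/-- The signs are undone inside the span of the idempotents; this makes the map of group algebras
surjective. -/
theorem signed_mul_sum (c : ProjClifford n) : signed c * ∑ a, sg (sgn c a) • idem a = dl c := by
  simp only [Finset.mul_sum, mul_smul_comm, signed_mul_idem, smul_smul, sg_mul_self, one_smul]
  rw [← Finset.mul_sum, sum_idem, mul_one]

/-- The embedding of the affine symplectic group into the group algebra `ℂ[C_n]` defined by a
section. -/
def psi {t : Sp n → ProjClifford n} (ht : IsAdaptedSection t) : AffineSp n →* CliffAlg n where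
  toFun s := dl (weylClass s.left.toAdd) * signed (t s.right)
  map_one' := by
    rw [SemidirectProduct.one_left, SemidirectProduct.one_right, ht.normalized, signed_one,
      toAdd_one, weylClass_zero, map_one, one_mul]
  map_mul' r s := by
    rw [SemidirectProduct.mul_left, SemidirectProduct.mul_right, toAdd_mul, weylClass_add, map_mul,
      signed_eq_of_proj_eq (c := t (r.right * s.right)) (d := t r.right * t s.right)
        (by rw [map_mul, ht.proj_eq, ht.proj_eq, ht.proj_eq]), signed_mul, mul_assoc, mul_assoc,
      ← mul_assoc (signed _) (dl _), signed_mul_dl_weylClass, ht.proj_eq, mul_assoc]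
    rfl

/-- A trace on `ℂ[C_n]` does not see the difference between `psi` and `phi`. -/
theorem trace_psi {t : Sp n → ProjClifford n} (ht : IsAdaptedSection t) (f : CliffAlg n →ₗ[ℂ] ℂ)
    (hf : ∀ u v, f (u * v) = f (v * u)) (s : AffineSp n) : f (psi ht s) = f (dl (phi t s)) := by
  have h1 : psi ht s = ∑ a, sg (sgn (t s.right) a) • (dl (phi t s) * idem a) := by
    change dl _ * signed _ = _
    simp only [signed, Finset.mul_sum, mul_smul_comm, phi, map_mul, mul_assoc]
  have h2 : dl (phi t s) = ∑ a, dl (phi t s) * idem a := by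
    rw [← Finset.mul_sum, sum_idem, mul_one]
  rw [h1, h2, map_sum, map_sum]
  simp only [← h2]
  refine Finset.sum_congr rfl fun a _ => ?_
  by_cases ha : act s.right a = a
  · rw [ht.sgn_eq_zero ha, sg_zero, one_smul]
  · have hp : proj (phi t s) = s.right := by
      rw [phi, map_mul, ht.proj_eq, proj_weylClass, one_mul]
    -- With `c = phi t s`, `f (c e_a) = f (e_a c e_a) = f (e_a e_{Γa} c)`, and `e_a e_{Γa} = 0`.
    have h3 : f (dl (phi t s) * idem a) = 0 := by
      rw [← idem_mul_self, ← mul_assoc, hf, dl_mul_idem, ← mul_assoc, hp,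
        idem_mul_idem_of_ne (Ne.symm ha), zero_mul, map_zero]
    rw [map_smul, h3, smul_zero]

instance : Finite (AffineSp n) :=
  Finite.of_injective (fun s : AffineSp n => (s.left.toAdd, s.right)) fun r s h => by
    simp only [Prod.mk.injEq] at h
    exact SemidirectProduct.ext (Multiplicative.toAdd.injective h.1) h.2

/-- The range contains the Weyl classes, hence the idempotents, and all `signed c`, hence every
group element. Both algebras have the same finite dimension because `phi t` is a bijection. -/
theorem lift_psi_bijective {t : Sp n → ProjClifford n} (ht : IsAdaptedSection t) :
    Function.Bijective (MonoidAlgebra.lift ℂ (CliffAlg n) (AffineSp n) (psi ht)) := by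
  set Ψ := MonoidAlgebra.lift ℂ (CliffAlg n) (AffineSp n) (psi ht) with hΨ
  have hpsi : ∀ s, psi ht s ∈ Ψ.range := fun s => ⟨MonoidAlgebra.of ℂ _ s, by
    rw [hΨ]
    exact MonoidAlgebra.lift_of _ _⟩
  have hweyl : ∀ x : Vec n, dl (weylClass x) ∈ Ψ.range := fun x => by
    have h := hpsi ⟨Multiplicative.ofAdd x, 1⟩
    change dl (weylClass x) * signed (t 1) ∈ _ at h
    rwa [ht.normalized, signed_one, mul_one] at h
  have hsigned : ∀ c : ProjClifford n, signed c ∈ Ψ.range := fun c => by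
    have h := hpsi ⟨1, proj c⟩
    change dl (weylClass 0) * signed (t (proj c)) ∈ _ at h
    rwa [weylClass_zero, map_one, one_mul, signed_eq_of_proj_eq (d := c) (ht.proj_eq _)] at h
  have hidem : ∀ a : Vec n, idem a ∈ Ψ.range := fun a =>
    Subalgebra.smul_mem _ (sum_mem fun x _ => Subalgebra.smul_mem _ (hweyl x) _) _
  have hdl : ∀ c : ProjClifford n, dl c ∈ Ψ.range := fun c => by
    rw [← signed_mul_sum]
    exact mul_mem (hsigned c) (sum_mem fun a _ => Subalgebra.smul_mem _ (hidem a) _)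
  have hsurj : Function.Surjective Ψ := fun u => by
    change u ∈ Ψ.range
    rw [← (MonoidAlgebra.basis (ProjClifford n) ℂ).linearCombination_repr u]
    exact sum_mem fun c _ => Subalgebra.smul_mem _ (by
      rw [MonoidAlgebra.basis_apply]
      exact hdl c) _
  have : Finite (ProjClifford n) := Finite.of_surjective _ (phi_bijective ht).2
  have hb := Module.Finite.of_basis (MonoidAlgebra.basis (ProjClifford n) ℂ)
  have hb' := Module.Finite.of_basis (MonoidAlgebra.basis (AffineSp n) ℂ)
  have hrank : Module.finrank ℂ (MonoidAlgebra ℂ (AffineSp n)) = Module.finrank ℂ (CliffAlg n) := by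
    rw [Module.finrank_eq_nat_card_basis (MonoidAlgebra.basis (AffineSp n) ℂ),
      Module.finrank_eq_nat_card_basis (MonoidAlgebra.basis (ProjClifford n) ℂ)]
    exact Nat.card_eq_of_bijective _ (phi_bijective ht)
  exact ⟨(LinearMap.injective_iff_surjective_of_finrank_eq_finrank (f := Ψ.toLinearMap) hrank).mpr
    hsurj, hsurj⟩

/-- The isomorphism between the group algebras of the affine symplectic group and of `C_n`. -/
def algEquiv {t : Sp n → ProjClifford n} (ht : IsAdaptedSection t) :
    MonoidAlgebra ℂ (AffineSp n) ≃ₐ[ℂ] CliffAlg n :=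
  AlgEquiv.ofBijective _ (lift_psi_bijective ht)

theorem algEquiv_of {t : Sp n → ProjClifford n} (ht : IsAdaptedSection t) (s : AffineSp n) :
    algEquiv ht (MonoidAlgebra.of ℂ _ s) = psi ht s :=
  MonoidAlgebra.lift_of _ _

/-! ### Transport of representations and class functions along isomorphisms of group algebras -/

section Transport

variable {G H : Type} [Group G] [Group H]

/-- The linear extension of a function on a group to the group algebra. -/
def linExt (k : G → ℂ) : MonoidAlgebra ℂ G →ₗ[ℂ] ℂ :=
  (MonoidAlgebra.basis G ℂ).constr ℂ k

theorem linExt_of (k : G → ℂ) (g : G) : linExt k (MonoidAlgebra.of ℂ G g) = k g := by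
  rw [MonoidAlgebra.of_apply, ← MonoidAlgebra.basis_apply, linExt, Module.Basis.constr_basis]

theorem linExt_mul_comm {k : G → ℂ} (hk : ∀ g h, k (g * h) = k (h * g)) (u v : MonoidAlgebra ℂ G) :
    linExt k (u * v) = linExt k (v * u) := by
  have h : (LinearMap.mul ℂ (MonoidAlgebra ℂ G)).compr₂ (linExt k) =
      (LinearMap.mul ℂ (MonoidAlgebra ℂ G)).flip.compr₂ (linExt k) := by
    refine (MonoidAlgebra.basis G ℂ).ext fun g => (MonoidAlgebra.basis G ℂ).ext fun h => ?_
    simp only [LinearMap.compr₂_apply, LinearMap.flip_apply, LinearMap.mul_apply',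
      MonoidAlgebra.basis_apply, ← MonoidAlgebra.of_apply, ← map_mul, linExt_of, hk g h]
  exact LinearMap.congr_fun₂ h u v

theorem eq_of_isConj {k : G → ℂ} (hk : ∀ g h, k (g * h) = k (h * g)) {g h : G} (hgh : IsConj g h) :
    k g = k h := by
  obtain ⟨c, rfl⟩ := isConj_iff.mp hgh
  rw [hk, inv_mul_cancel_left]

open Classical in
/-- The indicator function of the conjugacy class of `g`. -/
def classIndicator (g h : G) : ℂ := if IsConj g h then 1 else 0

theorem classIndicator_mul_comm (g h h' : G) :
    classIndicator g (h * h') = classIndicator g (h' * h) := by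
  have : IsConj (h * h') (h' * h) := isConj_iff.mpr ⟨h', by group⟩
  classical
  exact if_congr ⟨fun h => h.trans this, fun h => h.trans this.symm⟩ rfl rfl

theorem isConj_of_classIndicator_eq {g h : G} (h1 : classIndicator g g = classIndicator g h) :
    IsConj g h := by
  by_contra h2
  rw [classIndicator, if_pos (IsConj.refl g), classIndicator, if_neg h2] at h1
  exact one_ne_zero h1

variable {V : Type} [AddCommGroup V] [Module ℂ V]

theorem asAlgebraHom_mem (ρ : Representation ℂ G V) (W : Subrepresentation ρ)
    (u : MonoidAlgebra ℂ G) {v : V} (hv : v ∈ W.toSubmodule) :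
    ρ.asAlgebraHom u v ∈ W.toSubmodule := by
  rw [← (MonoidAlgebra.basis G ℂ).linearCombination_repr u, Finsupp.linearCombination_apply,
    Finsupp.sum, map_sum, LinearMap.sum_apply]
  refine sum_mem fun g _ => ?_
  rw [map_smul, LinearMap.smul_apply, MonoidAlgebra.basis_apply,
    Representation.asAlgebraHom_single_one]
  exact Submodule.smul_mem _ _ (W.apply_mem_toSubmodule g hv)

/-- The representation of `G` obtained from a representation of `H` and a homomorphism of the group
algebras. -/
def pullRep (A : MonoidAlgebra ℂ G ≃ₐ[ℂ] MonoidAlgebra ℂ H) (ρ : Representation ℂ H V) :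
    Representation ℂ G V :=
  ((ρ.asAlgebraHom.comp A.toAlgHom : MonoidAlgebra ℂ G →ₐ[ℂ] Module.End ℂ V) :
    MonoidAlgebra ℂ G →* Module.End ℂ V).comp (MonoidAlgebra.of ℂ G)

theorem pullRep_apply (A : MonoidAlgebra ℂ G ≃ₐ[ℂ] MonoidAlgebra ℂ H) (ρ : Representation ℂ H V)
    (g : G) : pullRep A ρ g = ρ.asAlgebraHom (A (MonoidAlgebra.of ℂ G g)) := rfl

theorem asAlgebraHom_pullRep (A : MonoidAlgebra ℂ G ≃ₐ[ℂ] MonoidAlgebra ℂ H)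
    (ρ : Representation ℂ H V) (u : MonoidAlgebra ℂ G) :
    (pullRep A ρ).asAlgebraHom u = ρ.asAlgebraHom (A u) := by
  have h : (pullRep A ρ).asAlgebraHom = ρ.asAlgebraHom.comp A.toAlgHom :=
    (MonoidAlgebra.lift ℂ (Module.End ℂ V) G).apply_symm_apply _
  rw [h]
  rfl

/-- Pulling back along an isomorphism of group algebras does not change the invariant subspaces. -/
def pullRepOrderIso (A : MonoidAlgebra ℂ G ≃ₐ[ℂ] MonoidAlgebra ℂ H) (ρ : Representation ℂ H V) :
    Subrepresentation ρ ≃o Subrepresentation (pullRep A ρ) where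
  toFun W := ⟨W.toSubmodule, fun _ _ hv => asAlgebraHom_mem ρ W _ hv⟩
  invFun W := ⟨W.toSubmodule, fun h v hv => by
    have h1 := asAlgebraHom_mem (pullRep A ρ) W (A.symm (MonoidAlgebra.of ℂ H h)) hv
    rwa [asAlgebraHom_pullRep, AlgEquiv.apply_symm_apply, Representation.asAlgebraHom_of] at h1⟩
  left_inv _ := rfl
  right_inv _ := rfl
  map_rel_iff' := Iff.rfl

theorem pullRep_isIrreducible (A : MonoidAlgebra ℂ G ≃ₐ[ℂ] MonoidAlgebra ℂ H)
    {ρ : Representation ℂ H V} (h : ρ.IsIrreducible) : (pullRep A ρ).IsIrreducible :=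
  (pullRepOrderIso A ρ).isSimpleOrder_iff.mp h

end Transport

/-! ### Traces under the isomorphism of group algebras -/

variable {t : Sp n → ProjClifford n}

theorem trace_algEquiv_of (ht : IsAdaptedSection t) {f : CliffAlg n →ₗ[ℂ] ℂ}
    (hf : ∀ u v, f (u * v) = f (v * u)) (s : AffineSp n) :
    f (algEquiv ht (MonoidAlgebra.of ℂ _ s)) = f (MonoidAlgebra.of ℂ _ (phi t s)) := by
  rw [algEquiv_of, trace_psi ht f hf]
  rfl

theorem trace_algEquiv_symm_of (ht : IsAdaptedSection t)
    {f : MonoidAlgebra ℂ (AffineSp n) →ₗ[ℂ] ℂ} (hf : ∀ u v, f (u * v) = f (v * u))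
    (s : AffineSp n) :
    f ((algEquiv ht).symm (MonoidAlgebra.of ℂ _ (phi t s))) = f (MonoidAlgebra.of ℂ _ s) := by
  have h := trace_algEquiv_of ht (f := f.comp (algEquiv ht).symm.toLinearMap)
    (fun u v => by
      simp only [LinearMap.comp_apply, AlgEquiv.toLinearMap_apply, map_mul]
      exact hf _ _) s
  rw [LinearMap.comp_apply, LinearMap.comp_apply, AlgEquiv.toLinearMap_apply,
    AlgEquiv.toLinearMap_apply, AlgEquiv.symm_apply_apply] at h
  exact h.symm

/-! ### The main theorem -/

/-- The linear extension of a class indicator is a trace. Carried over by the algebra isomorphism it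
is again a trace, so it is constant on the conjugacy classes of the other group, and its values are
read off through `phi t`. -/
theorem isConj_phi_iff (ht : IsAdaptedSection t) (r s : AffineSp n) :
    IsConj r s ↔ IsConj (phi t r) (phi t s) := by
  constructor
  · intro h
    have hk := linExt_mul_comm (classIndicator_mul_comm (phi t r))
    refine isConj_of_classIndicator_eq ?_
    have h1 : ∀ s, classIndicator (phi t r) (phi t s) =
        linExt (classIndicator (phi t r)) (algEquiv ht (MonoidAlgebra.of ℂ _ s)) := fun s => by
      rw [trace_algEquiv_of ht hk, linExt_of]
    rw [h1, h1]
    exact eq_of_isConj (k := fun s => linExt (classIndicator (phi t r))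
      (algEquiv ht (MonoidAlgebra.of ℂ _ s))) (fun g h => by simp only [map_mul]; exact hk _ _) h
  · intro h
    have hk := linExt_mul_comm (classIndicator_mul_comm r)
    refine isConj_of_classIndicator_eq ?_
    have h1 : ∀ s, classIndicator r s = linExt (classIndicator r)
        ((algEquiv ht).symm (MonoidAlgebra.of ℂ _ (phi t s))) := fun s => by
      rw [trace_algEquiv_symm_of ht hk, linExt_of]
    rw [h1, h1]
    exact eq_of_isConj (k := fun c => linExt (classIndicator r)
      ((algEquiv ht).symm (MonoidAlgebra.of ℂ _ c))) (fun g h => by simp only [map_mul]; exact hk _ _) h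

theorem character_pullRep_algEquiv (ht : IsAdaptedSection t) {V : Type} [AddCommGroup V]
    [Module ℂ V] (ρ : Representation ℂ (ProjClifford n) V) :
    (pullRep (algEquiv ht) ρ).character = ρ.character ∘ phi t := by
  funext s
  have h := trace_algEquiv_of ht (f := (LinearMap.trace ℂ V).comp ρ.asAlgebraHom.toLinearMap)
    (fun u v => by simpa using LinearMap.trace_mul_comm ℂ _ _) s
  rw [LinearMap.comp_apply, LinearMap.comp_apply, AlgHom.toLinearMap_apply,
    AlgHom.toLinearMap_apply, Representation.asAlgebraHom_of] at h
  exact h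

theorem isIrreducibleCharacter_comp_phi_iff (ht : IsAdaptedSection t) (χ : ProjClifford n → ℂ) :
    IsIrreducibleCharacter χ ↔ IsIrreducibleCharacter (χ ∘ phi t) := by
  constructor
  · rintro ⟨V, _, _, _, ρ, hρ, rfl⟩
    exact ⟨V, _, _, ‹_›, pullRep (algEquiv ht) ρ, pullRep_isIrreducible _ hρ,
      character_pullRep_algEquiv ht ρ⟩
  · rintro ⟨V, _, _, _, ρ, hρ, h⟩
    refine ⟨V, _, _, ‹_›, pullRep (algEquiv ht).symm ρ, pullRep_isIrreducible _ hρ, ?_⟩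
    have h1 : pullRep (algEquiv ht) (pullRep (algEquiv ht).symm ρ) = ρ := by
      ext1 s
      rw [pullRep_apply, asAlgebraHom_pullRep, AlgEquiv.symm_apply_apply,
        Representation.asAlgebraHom_of]
    have h2 := character_pullRep_algEquiv ht (pullRep (algEquiv ht).symm ρ)
    rw [h1, h] at h2
    -- The two functions on `C_n` agree after composition with the surjection `phi t`.
    exact ((phi_bijective ht).2.injective_comp_right h2).symm

theorem haveIdenticalCharacterTables (ht : IsAdaptedSection t) :
    HaveIdenticalCharacterTables (AffineSp n) (ProjClifford n) := by
  let φ : AffineSp n ≃ ProjClifford n := Equiv.ofBijective _ (phi_bijective ht)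
  let e : ConjClasses (AffineSp n) ≃ ConjClasses (ProjClifford n) :=
    Quotient.congr φ (isConj_phi_iff ht)
  have hE : ∀ χ : AffineSp n → ℂ,
      IsIrreducibleCharacter χ ↔ IsIrreducibleCharacter (φ.arrowCongr (Equiv.refl ℂ) χ) := fun χ => by
    rw [isIrreducibleCharacter_comp_phi_iff ht]
    have : φ.arrowCongr (Equiv.refl ℂ) χ ∘ phi t = χ :=
      funext fun s => congrArg χ (φ.symm_apply_apply s)
    rw [this]
  refine ⟨e, (φ.arrowCongr (Equiv.refl ℂ)).subtypeEquiv hE, fun χ g h hgh => ?_⟩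
  have h1 : IsConj (φ g) (φ (φ.symm h)) := by
    rw [φ.apply_symm_apply]
    exact ConjClasses.mk_eq_mk_iff_isConj.mp hgh
  obtain ⟨V, _, _, _, ρ, -, hρ⟩ := χ.2
  change χ.1 (φ.symm h) = χ.1 g
  rw [← hρ]
  exact (eq_of_isConj (fun a b => ρ.char_mul_comm b a) ((isConj_phi_iff ht _ _).mpr h1)).symm

end CliffordTables

end

theorem mainTheorem8 (n : ℕ) :
    CliffordTables.HaveIdenticalCharacterTables
      (CliffordTables.AffineSp n) (CliffordTables.ProjClifford n) ∧
    (∃ t : CliffordTables.Sp n → CliffordTables.ProjClifford n,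
      CliffordTables.IsAdaptedSection t) ∧
    (∀ t : CliffordTables.Sp n → CliffordTables.ProjClifford n,
      CliffordTables.IsAdaptedSection t →
        Function.Bijective (CliffordTables.phi t) ∧
        (∀ r s : CliffordTables.AffineSp n,
          IsConj r s ↔ IsConj (CliffordTables.phi t r) (CliffordTables.phi t s)) ∧
        (∀ χ : CliffordTables.ProjClifford n → ℂ,
          CliffordTables.IsIrreducibleCharacter χ ↔
            CliffordTables.IsIrreducibleCharacter (χ ∘ CliffordTables.phi t))) := by
  obtain ⟨t, ht⟩ := CliffordTables.exists_isAdaptedSection n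
  exact ⟨CliffordTables.haveIdenticalCharacterTables ht, ⟨t, ht⟩, fun t ht =>
    ⟨CliffordTables.phi_bijective ht, CliffordTables.isConj_phi_iff ht,
      CliffordTables.isIrreducibleCharacter_comp_phi_iff ht⟩⟩
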